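/- Let $\mathbb T=\mathbb R/\mathbb Z$, identified with $[0,1)$, let $\lambda$ be Lebesgue measure, and let $\{x\}\in[0,1)$ denote the fractional part of $x\in\mathbb T$. **Quasi-similar Cantor sets.** Let $(m_i)_{i\ge1}$, $(k_i)_{i\ge1}$ be bounded sequences of natural numbers with $2\le m_i\le\lfloor k_i/2\rfloor$, and for each $i$ let $S_i\subset\{0,\dots,k_i-1\}$ be a set of $m_i$ elements which contains $0$ and $k_i-1$ and contains no two consecutive numbers. Put $A_0=[0,1]$. At step $i\geq 1$ divide each interval of $A_{i-1}$ into $k_i$ intervals of equal length, numbered $0,\dots,k_i-1$ from left to right, and let $A_i$ be the union of the closed intervals whose number lies in $S_i$ (the same $S_i$ in every interval of $A_{i-1}$). The set $\mathcal C=\bigcap_i A_i$ is a quasi-similar Cantor set. Let $f_n:[0,1]\to[0,1]$ be the continuous function with $f_n(0)=0$ which increases linearly by $1/(m_1\cdots m_n)$ on each of the $m_1\cdots m_n$ intervals of $A_n$ and is constant on each component of $[0,1]\setminus A_n$. The non-decreasing Cantor function of $\mathcal C$ is the uniform limit $f(\mathcal C)=\lim_n f_n$. **Special flows.** Let $T$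 be an invertible measure-preserving map of $(X,\mu)$ and $f:X\to(0,\infty)$ integrable. Write $f^{(n)}(x)=\sum_{i=0}^{n-1}f(T^ix)$ for $n\ge0$ and $f^{(-n)}(x)=-f^{(n)}(T^{-n}x)$ for $n\geq 1$. The special flow $(T^f_t)_{t\in\mathbb R}$ acts on $X^f=\{(x,s):x\in X,\ 0\le s<f(x)\}$, with the restriction $\mu^f$ of $\mu\times\lambda$ to $X^f$, by $T^f_t(x,s)=(T^nx,\ s+t-f^{(n)}(x))$, where $n\in\mathbb Z$ is the integer with $f^{(n)}(x)\le s+t<f^{(n+1)}(x)$. A flow $(S_t)$ preserving a finite measure $\nu$ is *partially rigid* if there are $0<u\le1$ and a sequence $t_n\to+\infty$ such that $\liminf_{n\to\infty}\nu(A\cap S_{t_n}^{-1}A)\ge u\,\nu(A)$ for every measurable set $A$. **Theorem.** Let $\alpha$ be irrational with bounded partial quotients (the sequence $a_1,a_2,\dots$ of partial quotients of its continued fraction is bounded), and let $Tx=x+\alpha$ on $(\mathbb T,\lambda)$. Let $f:\mathbb T\to\mathbb R$ be strictly positive and of the form $$f(x)=f_a(x)+f_j(x)+f_s(x)+\tilde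 S\{x\},$$ where $f_a$ is absolutely continuous on $\mathbb T$, $f_j$ is a jump function with finitely many jumps (that is, $f_j$ is locally constant off a finite subset of $\mathbb T$), $f_s(x)=f(\mathcal C)(\{x\})$ for the non-decreasing Cantor function $f(\mathcal C)$ of a quasi-similar Cantor set $\mathcal C$, and $\tilde S>0$. Then the special flow $(T^f_t)_{t\in\mathbb R}$ is not partially rigid. -/

import Mathlib

open MeasureTheory Filter Topology

noncomputable section

/-! ### Quasi-similar Cantor sets and their Cantor functions -/

/-- The data of a quasi-similar Cantor set. At step `i` (with `i = 0, 1, 2, …`) every interval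
chosen so far is divided into `k i` intervals of equal length, numbered `0, …, k i - 1` from left
to right, and those whose number lies in `S i` are kept. The configuration `S i` is the same
in all the intervals of one step. It contains the first and the last number, and no two consecutive
numbers, i.e. the closures of the kept intervals are pairwise disjoint. Its size is `m i`. -/
structure QuasiSimilarData where
  k : ℕ → ℕ
  m : ℕ → ℕ
  S : ℕ → Finset ℕ
  bounded_k : ∃ K, ∀ i, k i ≤ K
  bounded_m : ∃ M, ∀ i, m i ≤ M
  two_le_m : ∀ i, 2 ≤ m i
  m_le : ∀ i, m i ≤ k i / 2
  card_S : ∀ i, (S i).card = m i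
  lt_k : ∀ i, ∀ j ∈ S i, j < k i
  first_mem : ∀ i, 0 ∈ S i
  last_mem : ∀ i, k i - 1 ∈ S i
  separated : ∀ i, ∀ j ∈ S i, j + 1 ∉ S i

namespace QuasiSimilarData

variable (D : QuasiSimilarData)

/-- `K n = k₁ ⋯ kₙ`. -/
def K (n : ℕ) : ℕ := ∏ i ∈ Finset.range n, D.k i

/-- `M n = m₁ ⋯ mₙ`. -/
def M (n : ℕ) : ℕ := ∏ i ∈ Finset.range n, D.m i

/-- The numbers `a` such that `[a / K n, (a + 1) / K n]` is one of the intervals chosen at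
step `n`. -/
def index : ℕ → Finset ℕ
  | 0 => {0}
  | n + 1 => (index n ×ˢ D.S n).image fun p => D.k n * p.1 + p.2

/-- The closed set `Aₙ`, the union of the closed intervals chosen at step `n`
(with `A₀ = [0, 1]`). -/
def stage (n : ℕ) : Set ℝ :=
  ⋃ a ∈ D.index n, Set.Icc ((a : ℝ) / D.K n) (((a : ℝ) + 1) / D.K n)

/-- The quasi-similar Cantor set. -/
def cantorSet : Set ℝ := ⋂ n, D.stage n

/-- The piecewise linear function which rises linearly by `1 / (m₁ ⋯ mₙ)` on each of the intervals
of `stage n`, is constant off `stage n`, and vanishes at `0`. -/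
def cantorApprox (n : ℕ) (x : ℝ) : ℝ :=
  ∑ a ∈ D.index n, max 0 (min 1 (D.K n * x - a)) / D.M n

/-- The non-decreasing Cantor function of the quasi-similar Cantor set: the limit of the functions
`cantorApprox n`. -/
def cantorFun (x : ℝ) : ℝ := limUnder atTop fun n => D.cantorApprox n x

theorem M_ge (n : ℕ) : (2 : ℝ) ^ n ≤ D.M n := by
  have : 2 ^ n ≤ D.M n := by
    have := Finset.pow_card_le_prod (Finset.range n) D.m 2 (fun i _ => D.two_le_m i)
    simpa [M] using this
  exact_mod_cast this

theorem k_pos (i : ℕ) : 0 < D.k i := (Nat.zero_le 0).trans_lt (D.lt_k i 0 (D.first_mem i))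

theorem step_bound (i : ℕ) (y : ℝ) :
    |(∑ j ∈ D.S i, max 0 (min 1 (D.k i * y - j))) / D.m i - max 0 (min 1 y)| ≤
      if 0 < y ∧ y < 1 then 1 else 0 := by
  have hm : (0 : ℝ) < D.m i := by have := D.two_le_m i; exact_mod_cast (by omega : 0 < D.m i)
  have hk : (0 : ℝ) < D.k i := by exact_mod_cast D.k_pos i
  have hcard : ∑ j ∈ D.S i, (1 : ℝ) = D.m i := by simp [D.card_S]
  split_ifs with h
  · have h0 : 0 ≤ (∑ j ∈ D.S i, max 0 (min 1 (D.k i * y - j))) / D.m i :=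
      div_nonneg (Finset.sum_nonneg fun j _ => le_max_left _ _) hm.le
    have h1 : (∑ j ∈ D.S i, max 0 (min 1 (D.k i * y - j))) / D.m i ≤ 1 := by
      rw [div_le_one hm, ← hcard]
      exact Finset.sum_le_sum fun j _ => max_le zero_le_one (min_le_left _ _)
    have h2 : 0 ≤ max 0 (min 1 y) := le_max_left _ _
    have h3 : max 0 (min 1 y) ≤ 1 := max_le zero_le_one (min_le_left _ _)
    rw [abs_le]; constructor <;> linarith
  · rcases le_or_gt y 0 with hy | hy
    · have hz : ∀ j ∈ D.S i, max 0 (min 1 (D.k i * y - (j : ℝ))) = 0 := by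
        intro j _
        refine max_eq_left ((min_le_right _ _).trans ?_)
        have : (0 : ℝ) ≤ j := j.cast_nonneg
        nlinarith
      rw [Finset.sum_eq_zero hz, max_eq_left ((min_le_right _ _).trans hy)]
      simp
    · have hy1 : 1 ≤ y := not_lt.1 fun h' => h ⟨hy, h'⟩
      have hz : ∀ j ∈ D.S i, max 0 (min 1 (D.k i * y - (j : ℝ))) = 1 := by
        intro j hj
        have hjk : (j : ℝ) + 1 ≤ D.k i := by exact_mod_cast D.lt_k i j hj
        rw [min_eq_left (by nlinarith), max_eq_right zero_le_one]
      rw [Finset.sum_congr rfl hz, hcard, min_eq_left hy1, max_eq_right zero_le_one,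
        div_self hm.ne']
      simp

theorem cantorApprox_succ (n : ℕ) (x : ℝ) :
    D.cantorApprox (n + 1) x = ∑ a ∈ D.index n,
      (∑ j ∈ D.S n, max 0 (min 1 (D.k n * (D.K n * x - a) - j))) / D.m n / D.M n := by
  have hinj : Set.InjOn (fun p : ℕ × ℕ => D.k n * p.1 + p.2)
      ((D.index n ×ˢ D.S n : Finset (ℕ × ℕ)) : Set (ℕ × ℕ)) := by
    rintro ⟨a, j⟩ h ⟨b, l⟩ h' e
    simp only [Finset.coe_product, Set.mem_prod, Finset.mem_coe] at h h' e
    have hj := D.lt_k n j h.2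
    have hl := D.lt_k n l h'.2
    have hab : a = b := by
      have := congrArg (· / D.k n) e
      simpa [Nat.mul_add_div (D.k_pos n), Nat.div_eq_of_lt hj, Nat.div_eq_of_lt hl] using this
    subst hab
    simp at e
    simp [e]
  rw [cantorApprox, index, Finset.sum_image hinj, Finset.sum_product]
  refine Finset.sum_congr rfl fun a _ => ?_
  rw [Finset.sum_div, Finset.sum_div]
  refine Finset.sum_congr rfl fun j _ => ?_
  simp only [K, M, Finset.prod_range_succ, Nat.cast_mul, Nat.cast_add]
  rw [div_div, mul_comm (D.m n : ℝ)]
  congr 3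
  ring_nf

theorem dist_cantorApprox_succ (n : ℕ) (x : ℝ) :
    dist (D.cantorApprox n x) (D.cantorApprox (n + 1) x) ≤ 1 * (1 / 2 : ℝ) ^ n := by
  have hM : (0 : ℝ) < D.M n := (by positivity : (0 : ℝ) < 2 ^ n).trans_le (D.M_ge n)
  rw [dist_comm, Real.dist_eq, cantorApprox_succ, cantorApprox, ← Finset.sum_sub_distrib]
  have key : ∑ a ∈ D.index n, (if 0 < D.K n * x - (a : ℝ) ∧ D.K n * x - (a : ℝ) < 1
      then (1 : ℝ) else 0) ≤ 1 := by
    rw [Finset.sum_ite, Finset.sum_const_zero, add_zero, Finset.sum_const, nsmul_eq_mul, mul_one]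
    have : ((D.index n).filter fun a : ℕ => 0 < D.K n * x - (a : ℝ) ∧
        D.K n * x - (a : ℝ) < 1).card ≤ 1 := by
      rw [Finset.card_le_one]
      intro a ha b hb
      simp only [Finset.mem_filter] at ha hb
      have h1 : (a : ℝ) < b + 1 := by linarith [ha.2.1, hb.2.2]
      have h2 : (b : ℝ) < a + 1 := by linarith [hb.2.1, ha.2.2]
      have h1' : a < b + 1 := by exact_mod_cast h1
      have h2' : b < a + 1 := by exact_mod_cast h2
      omega
    exact_mod_cast this
  calc _ ≤ ∑ a ∈ D.index n, (if 0 < D.K n * x - (a : ℝ) ∧ D.K n * x - (a : ℝ) < 1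
        then (1 : ℝ) else 0) / D.M n := by
        refine (Finset.abs_sum_le_sum_abs _ _).trans (Finset.sum_le_sum fun a _ => ?_)
        rw [← sub_div, abs_div, abs_of_pos hM]
        exact div_le_div_of_nonneg_right (D.step_bound n _) hM.le
    _ ≤ 1 / D.M n := by
        rw [← Finset.sum_div]
        exact div_le_div_of_nonneg_right key hM.le
    _ ≤ 1 * (1 / 2 : ℝ) ^ n := by
        rw [one_mul, one_div_pow]
        exact one_div_le_one_div_of_le (by positivity) (D.M_ge n)

/-- The defining limit of the Cantor function exists at every point. -/
theorem tendsto_cantorApprox (x : ℝ) :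
    Tendsto (fun n => D.cantorApprox n x) atTop (𝓝 (D.cantorFun x)) :=
  (cauchySeq_of_le_geometric (1 / 2 : ℝ) 1 (by norm_num)
    fun n => D.dist_cantorApprox_succ n x).tendsto_limUnder

/-- The convergence is uniform. -/
theorem tendstoUniformly_cantorApprox :
    TendstoUniformly D.cantorApprox D.cantorFun atTop := by
  rw [Metric.tendstoUniformly_iff]
  intro ε hε
  have h : Tendsto (fun n : ℕ => 1 * (1 / 2 : ℝ) ^ n / (1 - 1 / 2)) atTop (𝓝 0) := by
    simpa using ((tendsto_pow_atTop_nhds_zero_of_lt_one (r := (1 / 2 : ℝ)) (by norm_num)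
      (by norm_num)).const_mul 1).div_const (1 - 1 / 2)
  filter_upwards [h.eventually (gt_mem_nhds hε)] with n hn x
  rw [dist_comm]
  exact (dist_le_of_le_geometric_of_tendsto (1 / 2 : ℝ) 1 (by norm_num)
    (fun n => D.dist_cantorApprox_succ n x) (D.tendsto_cantorApprox x) n).trans_lt hn

end QuasiSimilarData

/-! ### The rotation and functions on the circle -/

/-- The partial quotients `a₁, a₂, …` of the continued fraction expansion of `α` are bounded. -/
def HasBoundedPartialQuotients (α : ℝ) : Prop :=
  ∃ C : ℝ, ∀ (n : ℕ) (a : ℝ), (GenContFract.of α).partDens.get? n = some a → a ≤ C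

/-- The rotation `x ↦ x + α` of the circle `ℝ / ℤ`. -/
def circleRotation (α : ℝ) : UnitAddCircle ≃ UnitAddCircle := Equiv.addRight (α : UnitAddCircle)

/-- The fractional part `{x} ∈ [0, 1)` of a point of `ℝ / ℤ`. -/
def circleFract (x : UnitAddCircle) : ℝ := (AddCircle.equivIco 1 0 x : ℝ)

/-- Absolute continuity of a function on the circle (in particular there is no jump at `0`). -/
def IsAbsolutelyContinuousOnCircle (g : UnitAddCircle → ℝ) : Prop :=
  AbsolutelyContinuousOnInterval (fun t : ℝ => g (t : UnitAddCircle)) 0 1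

/-- A jump function on the circle with finitely many jumps, i.e. a piecewise constant function:
off a finite set it is locally constant. -/
def IsFiniteJumpFunction (g : UnitAddCircle → ℝ) : Prop :=
  ∃ B : Set UnitAddCircle, B.Finite ∧ ∀ x ∉ B, ∀ᶠ y in 𝓝 x, g y = g x

/-! ### Special flows -/

/-- The cocycle `f⁽ⁿ⁾` over an invertible map `T`, for all integers `n`:
`f⁽ⁿ⁾(x) = f(x) + ⋯ + f(Tⁿ⁻¹ x)` for `n ≥ 0` and `f⁽⁻ⁿ⁾(x) = - f⁽ⁿ⁾(T⁻ⁿ x)`. -/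
def cocycleSum {X : Type*} (T : X ≃ X) (f : X → ℝ) : ℤ → X → ℝ
  | Int.ofNat n, x => birkhoffSum T f n x
  | Int.negSucc n, x => -birkhoffSum T f (n + 1) (T.symm^[n + 1] x)

/-- The space `X^f = {(x, s) : 0 ≤ s < f x}` of the special flow, as a subset of `X × ℝ`. -/
def specialSpace {X : Type*} (f : X → ℝ) : Set (X × ℝ) := {p | 0 ≤ p.2 ∧ p.2 < f p.1}

/-- The measure of the special flow: the restriction to `X^f` of the product of `μ` with Lebesgue
measure. -/
def specialMeasure {X : Type*} [MeasurableSpace X] (μ : Measure X) (f : X → ℝ) :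
    Measure (X × ℝ) :=
  (μ.prod volume).restrict (specialSpace f)

/-- The integer `n` with `f⁽ⁿ⁾(x) ≤ r < f⁽ⁿ⁺¹⁾(x)`. -/
def specialIndex {X : Type*} (T : X ≃ X) (f : X → ℝ) (x : X) (r : ℝ) : ℤ :=
  Classical.epsilon fun n : ℤ => cocycleSum T f n x ≤ r ∧ r < cocycleSum T f (n + 1) x

/-- The special flow over `T` under the roof function `f`:
`T_t(x, s) = (Tⁿ x, s + t - f⁽ⁿ⁾(x))`, where `f⁽ⁿ⁾(x) ≤ s + t < f⁽ⁿ⁺¹⁾(x)`. -/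
def specialFlow {X : Type*} (T : X ≃ X) (f : X → ℝ) (t : ℝ) (p : X × ℝ) : X × ℝ :=
  ((T ^ specialIndex T f p.1 (p.2 + t) : Equiv.Perm X) p.1,
    p.2 + t - cocycleSum T f (specialIndex T f p.1 (p.2 + t)) p.1)

/-- Partial rigidity of a flow `(S_t)` with respect to a finite measure `μ`: there are `0 < u ≤ 1`
and times `t_n → +∞` with `liminf μ(A ∩ S_{t_n}⁻¹ A) ≥ u μ(A)` for every measurable `A`. -/
def IsPartiallyRigid {Y : Type*} [MeasurableSpace Y] (μ : Measure Y) (S : ℝ → Y → Y) : Prop :=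
  ∃ u : ENNReal, 0 < u ∧ u ≤ 1 ∧ ∃ t : ℕ → ℝ, Tendsto t atTop atTop ∧
    ∀ A : Set Y, MeasurableSet A →
      u * μ A ≤ liminf (fun n => μ (A ∩ S (t n) ⁻¹' A)) atTop

end

/-! Partial rigidity is tested on thin sets `E ×ˢ Set.Ico 0 ε` lying under the roof, with `E` open
and `f` bounded below on `E`. If a point of such a set returns to it at a time `t > ε`, then some
Birkhoff sum `f⁽ʲ⁾(x)` is within `ε` of `t` (`exists_abs_birkhoffSum_sub_lt`). The heart of the
proof is `RoofData.volume_le`: the set of such `x` has measure at most `C ε` for all large `t`, with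
`C` independent of `ε`. The set that returns then has measure at most `C ε²`, while partial rigidity
asks for at least `u λ(E) ε`, up to the liminf. This is impossible for small `ε`.

For the measure bound, linear growth of the sums confines `j` to a range `[κ n, n]` with `n` of
order `t`. Cut the circle into order `n` arcs of length at most `c / n`. Since `α` is badly
approximable, the first `n` translates of an arc are disjoint, so an arc meets each singularity of
`f` at most once along its orbit (`exists_bad_points`). Hence it splits into a bounded number of
cells on which `f⁽ʲ⁾` has no jumps.

On a cell three facts hold. The oscillation of `f⁽ʲ⁾` is bounded, again by disjointness, so only
boundedly many `j` can bring the sum near `t`. The linear part contributes slope `j * St`, and the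
nondecreasing Cantor part can only help. The absolutely continuous part has a derivative of mean
zero, so it costs a slope that is `o(j)` plus a small additive error (`exists_le_sum_sub`). Each
relevant `j` therefore accounts for a set of diameter `O(ε / n)`, and summing over `O(n)` cells
gives `O(ε)`. -/

/-! ### Bounded partial quotients imply bad approximability. -/

/-- Irrational numbers all of whose partial quotients are at most `C`. -/
def PartialQuotientsLE (C α : ℝ) : Prop :=
  Irrational α ∧ ∀ (n : ℕ) (a : ℝ), (GenContFract.of α).partDens.get? n = some a → a ≤ C

namespace PartialQuotientsLE

variable {C α : ℝ}

theorem fract_pos (h : PartialQuotientsLE C α) : 0 < Int.fract α := by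
  rw [Int.fract_pos]
  exact h.1.ne_int _

theorem inv_fract (h : PartialQuotientsLE C α) : PartialQuotientsLE C (Int.fract α)⁻¹ := by
  refine ⟨?_, fun n a hn => h.2 (n + 1) a ?_⟩
  · rw [irrational_inv_iff]
    exact h.1.sub_intCast _
  · rw [GenContFract.partDens, Stream'.Seq.map_get?] at hn ⊢
    rwa [GenContFract.of_s_succ]

theorem floor_inv_fract_le (h : PartialQuotientsLE C α) : (⌊(Int.fract α)⁻¹⌋ : ℝ) ≤ C := by
  refine h.2 0 _ ?_
  have := GenContFract.of_s_head h.fract_pos.ne'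
  rw [Stream'.Seq.head] at this
  rw [GenContFract.partDens, Stream'.Seq.map_get?, this]
  rfl

theorem one_le_floor_inv_fract (h : PartialQuotientsLE C α) : 1 ≤ ⌊(Int.fract α)⁻¹⌋ := by
  rw [Int.le_floor]
  exact_mod_cast (one_le_inv₀ h.fract_pos).2 (Int.fract_lt_one α).le

theorem one_le (h : PartialQuotientsLE C α) : 1 ≤ C :=
  le_trans (by exact_mod_cast h.one_le_floor_inv_fract) h.floor_inv_fract_le

theorem le_fract (h : PartialQuotientsLE C α) : 1 / (C + 1) ≤ Int.fract α := by
  have h1 : (Int.fract α)⁻¹ ≤ C + 1 :=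
    (Int.lt_floor_add_one _).le.trans (by linarith [h.floor_inv_fract_le])
  rw [one_div]
  exact inv_le_of_inv_le₀ h.fract_pos h1

theorem fract_mul (h : PartialQuotientsLE C α) :
    Int.fract α * (⌊(Int.fract α)⁻¹⌋ + Int.fract (Int.fract α)⁻¹) = 1 := by
  rw [Int.floor_add_fract, mul_inv_cancel₀ h.fract_pos.ne']

/-- Descent by two steps of the Gauss map, which preserve the sign of the error and replace `q` by a
smaller `r = q - a p`. The induction must run over all `α` with the same bound `C`. -/
theorem le_mul_sub (q : ℕ) : ∀ {α : ℝ}, PartialQuotientsLE C α → 0 < q → ∀ p : ℤ,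
    0 < p - q * Int.fract α → 1 / (C + 1) ^ 2 ≤ q * (p - q * Int.fract α) := by
  induction q using Nat.strong_induction_on with
  | _ q ih =>
    intro α h hq p hp
    have hC := h.one_le
    have hq1 : (1 : ℝ) ≤ q := by exact_mod_cast hq
    set x := Int.fract α with hx
    set a := ⌊x⁻¹⌋ with ha
    set y := Int.fract x⁻¹ with hy
    have hxy : x * (a + y) = 1 := h.fract_mul
    have hx0 : 0 < x := h.fract_pos
    have hy0 : 0 < y := h.inv_fract.fract_pos
    have hy1 : y < 1 := Int.fract_lt_one _
    have ha1 : (1 : ℝ) ≤ a := by exact_mod_cast h.one_le_floor_inv_fract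
    have hxl : 1 / (C + 1) ≤ x := h.le_fract
    have hyl : 1 / (C + 1) ≤ y := h.inv_fract.le_fract
    have hD : 0 < 1 / (C + 1) := by positivity
    have hsq : 1 / (C + 1) ^ 2 = 1 / (C + 1) * (1 / (C + 1)) := by field_simp
    have hxyl : 1 / (C + 1) ^ 2 ≤ x * y := by rw [hsq]; gcongr
    have key : (p : ℝ) - q * x = x * (p * y - ((q : ℝ) - a * p)) := by
      linear_combination (-(p : ℝ)) * hxy
    have hp0 : 0 < p := by
      have : (0 : ℝ) < p := by nlinarith
      exact_mod_cast this
    have hp1 : (1 : ℝ) ≤ p := by exact_mod_cast hp0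
    rcases le_or_gt (q : ℤ) p with hpq | hpq
    -- The descent stops when `q ≤ p` or `q - a p ≤ 0`; in both cases the error is already at least
    -- `x * y`, a product of two factors at least `1 / (C + 1)`.
    · have hpq' : (q : ℝ) ≤ p := by exact_mod_cast hpq
      have h1 : x * y ≤ 1 - x := by nlinarith
      have h2 : 1 - x ≤ p - q * x := by nlinarith [Int.fract_lt_one α]
      nlinarith
    · rcases le_or_gt ((q : ℤ) - a * p) 0 with hp' | hp'
      · have hp'' : ((q : ℝ) - a * p) ≤ 0 := by exact_mod_cast hp'
        have : x * y ≤ p - q * x := by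
          rw [key]
          apply mul_le_mul_of_nonneg_left _ hx0.le
          nlinarith
        nlinarith
      · obtain ⟨r, hr⟩ : ∃ r : ℕ, ((q : ℤ) - a * p) = r := Int.eq_ofNat_of_zero_le hp'.le
        have hr' : ((q : ℝ) - a * p) = r := by exact_mod_cast hr
        rw [hr] at hp'
        rw [hr'] at key
        have hr0 : (1 : ℝ) ≤ r := by exact_mod_cast hp'
        set b := ⌊y⁻¹⌋ with hb
        set z := Int.fract y⁻¹ with hz
        have hyz : y * (b + z) = 1 := h.inv_fract.fract_mul
        have hpos : 0 < p * y - r := by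
          rw [key] at hp
          exact pos_of_mul_pos_right hp hx0.le
        have key2 : p * y - r = y * (((p - b * r : ℤ) : ℝ) - r * z) := by
          push_cast
          linear_combination (r : ℝ) * hyz
        have hpos2 : 0 < ((p - b * r : ℤ) : ℝ) - r * z := by
          rw [key2] at hpos
          exact pos_of_mul_pos_right hpos hy0.le
        have hrq : r < q := by
          have h1 : (r : ℝ) < p := by nlinarith
          have h2 : (r : ℤ) < p := by exact_mod_cast h1
          omega
        have := ih r hrq h.inv_fract.inv_fract (by omega) _ hpos2
        refine this.trans ?_
        rw [key, key2]
        -- The error shrinks by the factor `x * y` over the two steps, and the gain from `r` to `q`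
        -- compensates for it.
        have hfac : (r : ℝ) ≤ q * x * y := by
          have : q * x * y - r = a * x * (p * y - r) := by
            linear_combination x * y * hr' + (r : ℝ) * hxy
          have : 0 ≤ a * x * (p * y - r) := by positivity
          linarith
        calc _ ≤ (q * x * y) * (((p - b * r : ℤ) : ℝ) - r * z) :=
              mul_le_mul_of_nonneg_right hfac hpos2.le
          _ = _ := by ring

theorem le_mul_abs_sub (h : PartialQuotientsLE C α) {q : ℕ} (hq : 0 < q) (p : ℤ) :
    1 / (C + 1) ^ 2 ≤ q * |q * α - p| := by
  have hC := h.one_le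
  have hq1 : (1 : ℝ) ≤ q := by exact_mod_cast hq
  obtain ⟨p', hp'⟩ : ∃ p' : ℤ, p' = p - q * ⌊α⌋ := ⟨_, rfl⟩
  have e : q * α - p = q * Int.fract α - p' := by
    rw [hp', Int.fract]; push_cast; ring
  rw [e]
  have hne : (q : ℝ) * Int.fract α - p' ≠ 0 := by
    rw [← e, sub_ne_zero]
    exact ((irrational_natCast_mul_iff.2 ⟨hq.ne', h.1⟩)).ne_int p
  rcases lt_or_gt_of_ne hne with hlt | hgt
  · rw [abs_of_neg hlt, neg_sub]
    exact le_mul_sub q h hq p' (by linarith)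
  · rw [abs_of_pos hgt]
    set x := Int.fract α with hx
    have hx0 : 0 < x := h.fract_pos
    have hxl : 1 / (C + 1) ≤ x := h.le_fract
    have hsq : 1 / (C + 1) ^ 2 ≤ 1 / (C + 1) :=
      one_div_le_one_div_of_le (by positivity) (by nlinarith)
    rcases le_or_gt p' 0 with hp | hp
    · have : (p' : ℝ) ≤ 0 := by exact_mod_cast hp
      have : x ≤ q * x - p' := by nlinarith
      nlinarith
    -- A single Gauss step flips the sign of the error and reduces to the one-sided estimate.
    · obtain ⟨r, rfl⟩ : ∃ r : ℕ, p' = r := Int.eq_ofNat_of_zero_le hp.le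
      have hxy := h.fract_mul
      rw [← hx] at hxy
      set a := ⌊x⁻¹⌋
      set y := Int.fract x⁻¹ with hy
      have key : (q : ℝ) * x - (r : ℤ) = x * (((q - a * r : ℤ) : ℝ) - r * y) := by
        push_cast
        linear_combination (r : ℝ) * hxy
      have hpos : 0 < ((q - a * r : ℤ) : ℝ) - r * y := by
        rw [key] at hgt
        exact pos_of_mul_pos_right hgt hx0.le
      refine (le_mul_sub r h.inv_fract (by omega) _ hpos).trans ?_
      rw [key, ← mul_assoc]
      refine mul_le_mul_of_nonneg_right ?_ hpos.le
      have : (r : ℝ) < q * x := by simpa using hgt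
      exact this.le

end PartialQuotientsLE

/-- Irrational numbers with bounded partial quotients are badly approximable. -/
theorem HasBoundedPartialQuotients.exists_le_mul_abs_sub {α : ℝ} (hα : Irrational α)
    (h : HasBoundedPartialQuotients α) :
    ∃ c : ℝ, 0 < c ∧ ∀ q : ℕ, 0 < q → ∀ p : ℤ, c ≤ q * |q * α - p| := by
  obtain ⟨C, hC⟩ := h
  have h : PartialQuotientsLE C α := ⟨hα, hC⟩
  have := h.one_le
  exact ⟨1 / (C + 1) ^ 2, by positivity, fun q hq p => h.le_mul_abs_sub hq p⟩

/-! ### Birkhoff sums of trigonometric polynomials and `L¹` approximation. -/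

theorem intCast_zsmul_coe_ne_zero {α : ℝ} (hα : Irrational α) {n : ℤ} (hn : n ≠ 0) :
    n • (α : UnitAddCircle) ≠ 0 := by
  rw [← AddCircle.coe_zsmul, Ne, AddCircle.coe_eq_zero_iff]
  rintro ⟨m, hm⟩
  have : Irrational (n * α) := irrational_intCast_mul_iff.2 ⟨hn, hα⟩
  exact this.ne_int m (by simpa using hm.symm)

theorem fourier_coe_ne_one {α : ℝ} (hα : Irrational α) {n : ℤ} (hn : n ≠ 0) :
    fourier n (α : UnitAddCircle) ≠ 1 := by
  intro h
  rw [fourier_apply] at h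
  have h1 : AddCircle.toCircle (n • (α : UnitAddCircle)) = 1 := by
    apply Subtype.ext
    simpa using h
  rw [← AddCircle.toCircle_zero (T := 1)] at h1
  exact intCast_zsmul_coe_ne_zero hα hn (AddCircle.injective_toCircle one_ne_zero h1)

theorem fourier_nsmul (n : ℤ) (a : UnitAddCircle) (i : ℕ) :
    fourier n (i • a) = fourier n a ^ i := by
  rw [fourier_apply, fourier_apply, smul_comm, AddCircle.toCircle_nsmul]
  simp

theorem integral_fourier_eq_zero {n : ℤ} (hn : n ≠ 0) :
    ∫ x : UnitAddCircle, fourier n x = 0 :=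
  integral_eq_zero_of_add_right_eq_neg (μ := (volume : Measure UnitAddCircle))
    (fourier_add_half_inv_index hn one_pos)

/-- The Birkhoff sums of a trigonometric polynomial over an irrational rotation stay at a bounded
distance from their expected value. -/
theorem exists_norm_birkhoff_sub_le {α : ℝ} (hα : Irrational α) {H : C(UnitAddCircle, ℂ)}
    (hH : H ∈ Submodule.span ℂ (Set.range (@fourier 1))) :
    ∃ K : ℝ, ∀ (j : ℕ) (x : UnitAddCircle),
      ‖∑ i ∈ Finset.range j, H (x + i • (α : UnitAddCircle)) - j * ∫ y, H y‖ ≤ K := by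
  have hint : ∀ F : C(UnitAddCircle, ℂ), Integrable F := fun F =>
    F.continuous.integrable_of_hasCompactSupport (HasCompactSupport.of_compactSpace _)
  induction hH using Submodule.span_induction with
  | mem F hF =>
    obtain ⟨n, rfl⟩ := hF
    by_cases hn : n = 0
    · subst hn
      exact ⟨0, fun j x => by simp [measureReal_def]⟩
    · set w := fourier n (α : UnitAddCircle) with hw
      -- The Birkhoff sum of a nontrivial character is a geometric sum with ratio `w ≠ 1` of modulus
      -- one.
      refine ⟨2 / ‖w - 1‖, fun j x => ?_⟩
      rw [integral_fourier_eq_zero hn, mul_zero, sub_zero]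
      have hadd : ∀ x y : UnitAddCircle, fourier n (x + y) = fourier n x * fourier n y := by
        intro x y
        simp [fourier_apply, AddCircle.toCircle_add]
      have hnorm : ∀ x : UnitAddCircle, ‖fourier n x‖ = 1 := fun x => by
        rw [fourier_apply]; exact Circle.norm_coe _
      simp_rw [hadd, fourier_nsmul]
      rw [← Finset.mul_sum, norm_mul, hnorm, one_mul, geom_sum_eq (fourier_coe_ne_one hα hn),
        norm_div]
      gcongr
      refine (norm_sub_le _ _).trans ?_
      rw [norm_pow, hnorm]
      norm_num
  | zero => exact ⟨0, fun j x => by simp⟩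
  | add F G _ _ hF hG =>
    obtain ⟨K, hK⟩ := hF
    obtain ⟨L, hL⟩ := hG
    refine ⟨K + L, fun j x => ?_⟩
    simp only [ContinuousMap.add_apply]
    rw [integral_add (hint F) (hint G), Finset.sum_add_distrib, mul_add, add_sub_add_comm]
    exact (norm_add_le _ _).trans (add_le_add (hK j x) (hL j x))
  | smul c F _ hF =>
    obtain ⟨K, hK⟩ := hF
    refine ⟨‖c‖ * K, fun j x => ?_⟩
    simp only [ContinuousMap.smul_apply]
    rw [integral_smul, ← Finset.smul_sum, mul_smul_comm, ← smul_sub, norm_smul]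
    exact mul_le_mul_of_nonneg_left (hK j x) (norm_nonneg _)

/-- A function of mean zero is `L¹`-close to a continuous function whose Birkhoff sums over an
irrational rotation grow slowly. -/
theorem exists_periodic_approx {α : ℝ} (hα : Irrational α) {g : ℝ → ℝ}
    (hg : IntervalIntegrable g volume 0 1) (h0 : ∫ x in (0 : ℝ)..1, g x = 0) {η : ℝ} (hη : 0 < η) :
    ∃ h : ℝ → ℝ, Continuous h ∧ Function.Periodic h 1 ∧ ∫ x in (0 : ℝ)..1, |g x - h x| ≤ η ∧
      ∃ K : ℝ, ∀ (j : ℕ) (x : ℝ), |∑ i ∈ Finset.range j, h (x + i * α)| ≤ j * η + K := by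
  have hgi : IntegrableOn g (Set.Ioc 0 1) := (intervalIntegrable_iff_integrableOn_Ioc_of_le
    zero_le_one).1 hg
  set G : UnitAddCircle → ℂ := AddCircle.liftIoc 1 0 (fun x => (g x : ℂ)) with hG
  have hGi : Integrable G := by
    rw [← memLp_one_iff_integrable]
    apply MemLp.memLp_liftIoc
    rw [memLp_one_iff_integrable, zero_add]
    exact hgi.ofReal
  have hGe : ∀ x ∈ Set.Ioc (0 : ℝ) 1, G (x : UnitAddCircle) = g x := fun x hx => by
    rw [hG, AddCircle.liftIoc_coe_apply (by simpa using hx)]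
  have hGint : ∫ x, G x = 0 := by
    rw [← UnitAddCircle.integral_preimage 0, zero_add,
      setIntegral_congr_fun measurableSet_Ioc hGe, integral_complex_ofReal,
      ← intervalIntegral.integral_of_le zero_le_one, h0, Complex.ofReal_zero]
  -- Half of `η` pays for the `L¹` approximation by a continuous function, the other half for its
  -- uniform approximation by a trigonometric polynomial.
  obtain ⟨φ, hφ, hφi⟩ := hGi.exists_boundedContinuous_integral_sub_le (half_pos hη)
  have hmem : (φ.toContinuousMap : C(UnitAddCircle, ℂ)) ∈
      (Submodule.span ℂ (Set.range (@fourier 1))).topologicalClosure := by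
    rw [span_fourier_closure_eq_top]; trivial
  obtain ⟨H, hHs, hH⟩ := Metric.mem_closure_iff.1 hmem (η / 2) (half_pos hη)
  have hHi : Integrable H :=
    H.continuous.integrable_of_hasCompactSupport (HasCompactSupport.of_compactSpace _)
  obtain ⟨K, hK⟩ := exists_norm_birkhoff_sub_le hα hHs
  have hGH : ∫ x, ‖G x - H x‖ ≤ η := by
    have hle : ∀ x, ‖G x - H x‖ ≤ ‖G x - φ x‖ + η / 2 := fun x => by
      refine (norm_sub_le_norm_sub_add_norm_sub _ (φ x) _).trans ?_
      gcongr
      rw [← dist_eq_norm]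
      exact (ContinuousMap.dist_apply_le_dist (f := φ.toContinuousMap) x).trans hH.le
    have hnn : Integrable (fun x => ‖G x - φ x‖) := (hGi.sub hφi).norm
    calc ∫ x, ‖G x - H x‖ ≤ ∫ x, (‖G x - φ x‖ + η / 2) :=
          integral_mono (hGi.sub hHi).norm (hnn.add (integrable_const _)) hle
      _ = (∫ x, ‖G x - φ x‖) + η / 2 := by
          rw [integral_add hnn (integrable_const _)]
          simp [measureReal_def]
      _ ≤ η := by linarith
  -- The mean of `H` need not vanish, but it is at most `η` because that of `G` does; this is the
  -- term `j * η`.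
  have hHint : ‖∫ x, H x‖ ≤ η := by
    have : ∫ x, H x = -∫ x, (G x - H x) := by
      rw [integral_sub hGi hHi, hGint]; simp
    rw [this, norm_neg]
    exact (norm_integral_le_integral_norm _).trans hGH
  refine ⟨fun x => (H (x : UnitAddCircle)).re, ?_, ?_, ?_, K, fun j x => ?_⟩
  · exact Complex.continuous_re.comp (H.continuous.comp (AddCircle.continuous_mk' 1))
  · intro x
    simp only [AddCircle.coe_add_period]
  · refine le_trans ?_ hGH
    rw [← UnitAddCircle.integral_preimage 0, zero_add, intervalIntegral.integral_of_le zero_le_one]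
    have hi : Integrable (fun x : ℝ => ‖G x - H x‖) (volume.restrict (Set.Ioc 0 1)) := by
      have := (UnitAddCircle.measurePreserving_mk 0).integrable_comp_of_integrable
        (hGi.sub hHi).norm
      rwa [zero_add] at this
    refine integral_mono_of_nonneg (Eventually.of_forall fun x => abs_nonneg _) hi ?_
    filter_upwards [ae_restrict_mem measurableSet_Ioc] with x hx
    rw [hGe x hx]
    simpa using Complex.abs_re_le_norm ((g x : ℂ) - H x)
  · have h1 := hK j x
    have h2 : ∑ i ∈ Finset.range j, (H ((x + i * α : ℝ) : UnitAddCircle)).re =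
        (∑ i ∈ Finset.range j, H (x + i • (α : UnitAddCircle))).re := by
      rw [Complex.re_sum]
      refine Finset.sum_congr rfl fun i _ => ?_
      rw [← AddCircle.coe_nsmul, nsmul_eq_mul, ← AddCircle.coe_add]
    rw [h2]
    refine (Complex.abs_re_le_norm _).trans ?_
    calc _ ≤ ‖∑ i ∈ Finset.range j, H (x + i • (α : UnitAddCircle)) - j * ∫ y, H y‖
          + ‖j * ∫ y, H y‖ := by
          simpa using norm_add_le (∑ i ∈ Finset.range j, H (x + i • (α : UnitAddCircle))
            - j * ∫ y, H y) (j * ∫ y, H y)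
      _ ≤ K + j * η := by
          rw [norm_mul, Complex.norm_natCast]
          gcongr
      _ = _ := add_comm _ _

/-! ### Increments and integrals over disjoint intervals. -/

namespace QuasiSimilarData

variable (D : QuasiSimilarData)

theorem monotone_cantorApprox (n : ℕ) : Monotone (D.cantorApprox n) := fun x y hxy => by
  unfold cantorApprox
  gcongr

theorem continuous_cantorApprox (n : ℕ) : Continuous (D.cantorApprox n) := by
  unfold cantorApprox
  fun_prop

theorem monotone_cantorFun : Monotone D.cantorFun := fun x y hxy =>
  le_of_tendsto_of_tendsto' (D.tendsto_cantorApprox x) (D.tendsto_cantorApprox y)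
    fun n => D.monotone_cantorApprox n hxy

theorem continuous_cantorFun : Continuous D.cantorFun :=
  D.tendstoUniformly_cantorApprox.continuous
    (Frequently.of_forall D.continuous_cantorApprox)

end QuasiSimilarData

/-- Increments are Stieltjes measures of half-open intervals, so disjointness turns the sum into the
measure of a subset of `(0, 1]`. -/
theorem sum_sub_le_of_pairwiseDisjoint {φ : ℝ → ℝ} (hφ : Monotone φ) (hc : Continuous φ)
    {ι : Type*} {s : Finset ι} {a b : ι → ℝ} (hab : ∀ i ∈ s, a i ≤ b i) (h0 : ∀ i ∈ s, 0 ≤ a i)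
    (h1 : ∀ i ∈ s, b i ≤ 1)
    (hd : (s : Set ι).PairwiseDisjoint fun i => Set.Ioc (a i) (b i)) :
    ∑ i ∈ s, (φ (b i) - φ (a i)) ≤ φ 1 - φ 0 := by
  have he : ∀ x, hφ.stieltjesFunction x = φ x := fun x => by
    rw [hφ.stieltjesFunction_eq]
    exact hc.continuousAt.continuousWithinAt.rightLim_eq
  have hm : ∀ x y, hφ.stieltjesFunction.measure (Set.Ioc x y) = ENNReal.ofReal (φ y - φ x) :=
    fun x y => by rw [StieltjesFunction.measure_Ioc, he, he]
  rw [← ENNReal.ofReal_le_ofReal_iff (sub_nonneg.2 (hφ zero_le_one)),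
    ENNReal.ofReal_sum_of_nonneg fun i hi => sub_nonneg.2 (hφ (hab i hi)), ← hm]
  simp_rw [← hm]
  rw [← measure_biUnion_finset hd fun i _ => measurableSet_Ioc]
  exact measure_mono (Set.iUnion₂_subset fun i hi => Set.Ioc_subset_Ioc (h0 i hi) (h1 i hi))

theorem sum_integral_abs_le_of_pairwiseDisjoint {u : ℝ → ℝ} (hu : IntervalIntegrable u volume 0 1)
    {ι : Type*} {s : Finset ι} {a b : ι → ℝ} (hab : ∀ i ∈ s, a i ≤ b i) (h0 : ∀ i ∈ s, 0 ≤ a i)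
    (h1 : ∀ i ∈ s, b i ≤ 1)
    (hd : (s : Set ι).PairwiseDisjoint fun i => Set.Ioc (a i) (b i)) :
    |∑ i ∈ s, ∫ x in a i..b i, u x| ≤ ∫ x in (0 : ℝ)..1, |u x| := by
  have hi : IntegrableOn (fun x => |u x|) (Set.Ioc 0 1) :=
    ((intervalIntegrable_iff_integrableOn_Ioc_of_le zero_le_one).1 hu).abs
  have hsub : ∀ i ∈ s, Set.Ioc (a i) (b i) ⊆ Set.Ioc 0 1 := fun i hi =>
    Set.Ioc_subset_Ioc (h0 i hi) (h1 i hi)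
  calc |∑ i ∈ s, ∫ x in a i..b i, u x| ≤ ∑ i ∈ s, ∫ x in Set.Ioc (a i) (b i), |u x| := by
        refine (Finset.abs_sum_le_sum_abs _ _).trans (Finset.sum_le_sum fun i hi => ?_)
        rw [← intervalIntegral.integral_of_le (hab i hi)]
        exact intervalIntegral.abs_integral_le_integral_abs (hab i hi)
    _ = ∫ x in ⋃ i ∈ s, Set.Ioc (a i) (b i), |u x| :=
        (integral_biUnion_finset s (fun i _ => measurableSet_Ioc) hd
          fun i hi' => hi.mono_set (hsub i hi')).symm
    _ ≤ ∫ x in Set.Ioc 0 1, |u x| :=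
        setIntegral_mono_set hi (Eventually.of_forall fun x => abs_nonneg _)
          (Set.iUnion₂_subset hsub).eventuallyLE
    _ = _ := (intervalIntegral.integral_of_le zero_le_one).symm

theorem circleFract_coe (x : ℝ) : circleFract (x : UnitAddCircle) = Int.fract x := by
  simp [circleFract, AddCircle.coe_equivIco_mk_apply]

theorem fract_eq_fract_add_sub {x y : ℝ} (hxy : x ≤ y)
    (h : ∀ z ∈ Set.Icc x y, (z : UnitAddCircle) ≠ 0) :
    Int.fract y = Int.fract x + (y - x) := by
  have : ⌊y⌋ = ⌊x⌋ := by
    refine le_antisymm ?_ (Int.floor_mono hxy)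
    by_contra! hlt
    refine h ⌊y⌋ ⟨?_, Int.floor_le y⟩ ?_
    · exact (Int.floor_lt.1 hlt).le
    · rw [AddCircle.coe_eq_zero_iff]
      exact ⟨⌊y⌋, by simp⟩
  rw [Int.fract, Int.fract, this]
  ring

/-! ### Separation of orbits and disjointness of translated arcs. -/

/-- The constant `c` witnesses that `α` is badly approximable. -/
def BadlyApproximable (c α : ℝ) : Prop :=
  0 < c ∧ ∀ q : ℕ, 0 < q → ∀ p : ℤ, c ≤ q * |q * α - p|

namespace BadlyApproximable

variable {c α : ℝ}

theorem div_le_abs (h : BadlyApproximable c α) {n i k : ℕ} (hi : i < n) (hk : k < n) (hik : i ≠ k)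
    (p : ℤ) : c / n ≤ |i * α - k * α - p| := by
  wlog hlt : k < i generalizing i k p
  · have := this hk hi hik.symm (-p) (by omega)
    rw [← abs_neg] at this
    convert this using 2
    push_cast
    ring
  obtain ⟨q, rfl⟩ := Nat.exists_eq_add_of_lt hlt
  have hn : (0 : ℝ) < n := by exact_mod_cast (by omega : 0 < n)
  have h1 := h.2 (q + 1) (by omega) p
  have h2 : ((q + 1 : ℕ) : ℝ) ≤ n := by exact_mod_cast (by omega : q + 1 ≤ n)
  have e : ((k + q + 1 : ℕ) : ℝ) * α - k * α - p = ((q + 1 : ℕ) : ℝ) * α - p := by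
    push_cast; ring
  rw [e, div_le_iff₀ hn, mul_comm]
  exact h1.trans (mul_le_mul_of_nonneg_right h2 (abs_nonneg _))

/-- Short arcs translated along an orbit are pairwise disjoint on the circle. -/
theorem pairwiseDisjoint (h : BadlyApproximable c α) {n j : ℕ} (hj : j ≤ n) {x y : ℝ}
    (hxy : y - x ≤ c / n) (hf : ∀ i < j, Int.fract (y + i * α) = Int.fract (x + i * α) + (y - x)) :
    (Finset.range j : Set ℕ).PairwiseDisjoint
      fun i : ℕ => Set.Ioc (Int.fract (x + i * α)) (Int.fract (y + i * α)) := by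
  intro i hi k hk hik
  simp only [Finset.coe_range, Set.mem_Iio] at hi hk
  rw [Function.onFun, Set.disjoint_left]
  intro z hz hz'
  rw [hf i hi] at hz
  rw [hf k hk] at hz'
  have h1 := h.div_le_abs (hi.trans_le hj) (hk.trans_le hj) hik
    (⌊x + i * α⌋ - ⌊x + k * α⌋)
  have e : (i * α - k * α - ((⌊x + i * α⌋ - ⌊x + k * α⌋ : ℤ) : ℝ)) =
      Int.fract (x + i * α) - Int.fract (x + k * α) := by
    rw [Int.fract, Int.fract]; push_cast; ring
  rw [e] at h1
  -- A common point would bring the left endpoints closer than the arc length, hence closer than `c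
  -- / n`.
  have h2 : |Int.fract (x + i * α) - Int.fract (x + k * α)| < y - x := by
    rw [abs_lt]
    constructor <;> linarith [hz.1, hz.2, hz'.1, hz'.2]
  linarith

end BadlyApproximable

/-! ### Birkhoff sums of the absolutely continuous part. -/

theorem sub_eq_integral_deriv {fa : UnitAddCircle → ℝ} (hfa : IsAbsolutelyContinuousOnCircle fa)
    {x y : ℝ} (hxy : x ≤ y) (h : Int.fract y = Int.fract x + (y - x)) :
    fa y - fa x = ∫ t in Int.fract x..Int.fract y, deriv (fun t : ℝ => fa t) t := by
  have hle : Int.fract x ≤ Int.fract y := by linarith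
  have hsub : Set.uIcc (Int.fract x) (Int.fract y) ⊆ Set.uIcc 0 1 := by
    rw [Set.uIcc_of_le hle, Set.uIcc_of_le zero_le_one]
    exact Set.Icc_subset_Icc (Int.fract_nonneg _) (Int.fract_lt_one _).le
  have := (AbsolutelyContinuousOnInterval.mono hfa hsub).integral_deriv_eq_sub
  simp only [AddCircle.coe_fract] at this
  exact this.symm

/-- On a short arc whose first `j` translates avoid `0`, the Birkhoff sums of an absolutely
continuous function have bounded oscillation. -/
theorem abs_sum_sub_le {c α : ℝ} (hα : BadlyApproximable c α) {fa : UnitAddCircle → ℝ}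
    (hfa : IsAbsolutelyContinuousOnCircle fa) {n j : ℕ} (hj : j ≤ n) {x y : ℝ} (hxy : x ≤ y)
    (hc : y - x ≤ c / n)
    (hf : ∀ i < j, Int.fract (y + i * α) = Int.fract (x + i * α) + (y - x)) :
    |∑ i ∈ Finset.range j, (fa ((y + i * α : ℝ)) - fa ((x + i * α : ℝ)))| ≤
      ∫ t in (0 : ℝ)..1, |deriv (fun t : ℝ => fa t) t| := by
  have hd := hα.pairwiseDisjoint hj hc hf
  rw [Finset.sum_congr rfl fun i hi => sub_eq_integral_deriv hfa (by linarith)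
    ((hf i (Finset.mem_range.1 hi)).trans (by ring))]
  refine sum_integral_abs_le_of_pairwiseDisjoint
    (AbsolutelyContinuousOnInterval.intervalIntegrable_deriv hfa) (fun i hi => ?_)
    (fun i _ => Int.fract_nonneg _) (fun i _ => (Int.fract_lt_one _).le) hd
  linarith [hf i (Finset.mem_range.1 hi)]

/-- On short arcs the Birkhoff sums of an absolutely continuous function grow with a slope that is
small compared to their length, up to a small error. -/
theorem exists_le_sum_sub {c α : ℝ} (hα : BadlyApproximable c α) (hirr : Irrational α)
    {fa : UnitAddCircle → ℝ} (hfa : IsAbsolutelyContinuousOnCircle fa) {η : ℝ} (hη : 0 < η) :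
    ∃ K : ℝ, ∀ n j : ℕ, j ≤ n → ∀ x y : ℝ, x ≤ y → y - x ≤ c / n →
      (∀ i < j, Int.fract (y + i * α) = Int.fract (x + i * α) + (y - x)) →
      -((j * η + K) * (y - x) + η) ≤
        ∑ i ∈ Finset.range j, (fa ((y + i * α : ℝ)) - fa ((x + i * α : ℝ))) := by
  set g : ℝ → ℝ := deriv (fun t : ℝ => fa t) with hg
  have hgi : IntervalIntegrable g volume 0 1 :=
    AbsolutelyContinuousOnInterval.intervalIntegrable_deriv hfa
  have hg0 : ∫ x in (0 : ℝ)..1, g x = 0 := by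
    rw [AbsolutelyContinuousOnInterval.integral_deriv_eq_sub hfa, AddCircle.coe_period,
      AddCircle.coe_zero, sub_self]
  obtain ⟨h, hc, hp, hgh, K, hK⟩ := exists_periodic_approx hirr hgi hg0 hη
  refine ⟨K, fun n j hj x y hxy hcn hf => ?_⟩
  have hd := hα.pairwiseDisjoint hj hcn hf
  have hle : ∀ i ∈ Finset.range j, Int.fract (x + i * α) ≤ Int.fract (y + i * α) := fun i hi => by
    linarith [hf i (Finset.mem_range.1 hi)]
  have h1 := sum_integral_abs_le_of_pairwiseDisjoint (hgi.sub (hc.intervalIntegrable 0 1)) hle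
    (fun i _ => Int.fract_nonneg _) (fun i _ => (Int.fract_lt_one _).le) hd
  have hgi' : ∀ i ∈ Finset.range j,
      IntervalIntegrable g volume (Int.fract (x + i * α)) (Int.fract (y + i * α)) := fun i hi =>
    hgi.mono_set (by
      rw [Set.uIcc_of_le (hle i hi), Set.uIcc_of_le zero_le_one]
      exact Set.Icc_subset_Icc (Int.fract_nonneg _) (Int.fract_lt_one _).le)
  -- Periodicity of `h` moves every translate back to `[x, y]`, where the slow growth of its
  -- Birkhoff sums applies pointwise.
  have e1 : ∑ i ∈ Finset.range j, ∫ t in Int.fract (x + i * α)..Int.fract (y + i * α), h t =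
      ∫ s in x..y, ∑ i ∈ Finset.range j, h (s + i * α) := by
    have hi : ∀ i ∈ Finset.range j, IntervalIntegrable (fun s => h (s + i * α)) volume x y :=
      fun i _ => (hc.comp (continuous_add_const _)).intervalIntegrable _ _
    rw [intervalIntegral.integral_finsetSum hi]
    refine Finset.sum_congr rfl fun i hi => ?_
    have hx : Int.fract (x + i * α) = x + (i * α - ⌊x + i * α⌋) := by rw [Int.fract]; ring
    have hy : Int.fract (y + i * α) = y + (i * α - ⌊x + i * α⌋) := by
      rw [hf i (Finset.mem_range.1 hi), Int.fract]; ring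
    rw [hx, hy, ← intervalIntegral.integral_comp_add_right]
    refine intervalIntegral.integral_congr fun s _ => ?_
    have := hp.sub_int_mul_eq (x := s + i * α) ⌊x + i * α⌋
    rw [mul_one] at this
    simp only [← add_sub_assoc, this]
  have e2 : |∫ s in x..y, ∑ i ∈ Finset.range j, h (s + i * α)| ≤ (j * η + K) * (y - x) := by
    have := intervalIntegral.norm_integral_le_of_norm_le_const (a := x) (b := y)
      (f := fun s => ∑ i ∈ Finset.range j, h (s + i * α)) (C := j * η + K) fun s _ => hK j s
    rwa [Real.norm_eq_abs, abs_of_nonneg (sub_nonneg.2 hxy)] at this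
  have e3 : ∑ i ∈ Finset.range j, (fa ((y + i * α : ℝ)) - fa ((x + i * α : ℝ))) =
      (∫ s in x..y, ∑ i ∈ Finset.range j, h (s + i * α)) +
      ∑ i ∈ Finset.range j, ∫ t in Int.fract (x + i * α)..Int.fract (y + i * α), (g t - h t) := by
    rw [← e1, ← Finset.sum_add_distrib]
    refine Finset.sum_congr rfl fun i hi => ?_
    rw [sub_eq_integral_deriv hfa (by linarith) ((hf i (Finset.mem_range.1 hi)).trans (by ring)),
      intervalIntegral.integral_sub (hgi' i hi) (hc.intervalIntegrable _ _)]
    ring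
  rw [e3]
  have := h1.trans hgh
  linarith [neg_abs_le (∫ s in x..y, ∑ i ∈ Finset.range j, h (s + i * α)),
    neg_abs_le (∑ i ∈ Finset.range j,
      ∫ t in Int.fract (x + i * α)..Int.fract (y + i * α), (g t - h t))]

/-! ### Jump functions and counting singular points. -/

/-- The number of points of `P` to the left of `x`. -/
noncomputable def countLT (P : Finset ℝ) (x : ℝ) : ℕ := (P.filter (· < x)).card

theorem countLT_le (P : Finset ℝ) (x : ℝ) : countLT P x ≤ P.card := Finset.card_filter_le _ _

/-- Off `P`, the level sets of `countLT P` are the gaps between consecutive points of `P`; these are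
the cells used below. -/
theorem notMem_of_countLT_eq {P : Finset ℝ} {x y : ℝ} (hx : x ∉ P) (hy : y ∉ P)
    (h : countLT P x = countLT P y) {z : ℝ} (hz : z ∈ Set.Icc x y) : z ∉ P := by
  intro hzP
  have hxz : x < z := lt_of_le_of_ne hz.1 fun e => hx (e ▸ hzP)
  have hzy : z < y := lt_of_le_of_ne hz.2 fun e => hy (e ▸ hzP)
  refine h.not_lt (Finset.card_lt_card (Finset.ssubset_iff_subset_ne.2 ⟨fun p hp => ?_, fun e => ?_⟩))
  · rw [Finset.mem_filter] at hp ⊢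
    exact ⟨hp.1, hp.2.trans (hxz.trans hzy)⟩
  · have : z ∈ P.filter (· < y) := Finset.mem_filter.2 ⟨hzP, hzy⟩
    rw [← e, Finset.mem_filter] at this
    exact lt_asymm this.2 hxz

theorem eq_of_locally_constant {fj : UnitAddCircle → ℝ} {B : Set UnitAddCircle}
    (hB : ∀ x ∉ B, ∀ᶠ y in 𝓝 x, fj y = fj x) {x y : ℝ} (hxy : x ≤ y)
    (h : ∀ z ∈ Set.Icc x y, (z : UnitAddCircle) ∉ B) : fj y = fj x := by
  have hd : ∀ z ∈ Set.Icc x y, HasDerivAt (fun t : ℝ => fj t) 0 z := fun z hz =>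
    (hasDerivAt_const z (fj z)).congr_of_eventuallyEq
      ((AddCircle.continuous_mk' 1).continuousAt.eventually (hB z (h z hz)))
  exact constant_of_has_deriv_right_zero (f := fun t : ℝ => fj t)
    (fun z hz => (hd z hz).continuousAt.continuousWithinAt)
    (fun z hz => (hd z ⟨hz.1, hz.2.le⟩).hasDerivWithinAt) y ⟨hxy, le_rfl⟩

/-- The points of `[0, 1)` that represent a set of points of the circle. -/
theorem finite_representatives {B : Set UnitAddCircle} (hB : B.Finite) :
    {x : ℝ | x ∈ Set.Ico 0 1 ∧ (x : UnitAddCircle) ∈ B}.Finite := by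
  refine (hB.image circleFract).subset ?_
  rintro x ⟨hx, hxB⟩
  exact ⟨x, hxB, by rw [circleFract_coe, Int.fract_eq_self.2 hx]⟩

theorem IsFiniteJumpFunction.finite_range {fj : UnitAddCircle → ℝ} (h : IsFiniteJumpFunction fj) :
    (Set.range fj).Finite := by
  obtain ⟨B, hBf, hB⟩ := h
  set P := (finite_representatives hBf).toFinset with hP
  have hmem : ∀ x ∈ Set.Ico (0 : ℝ) 1, x ∉ P → (x : UnitAddCircle) ∉ B := fun x hx hxP hxB =>
    hxP ((finite_representatives hBf).mem_toFinset.2 ⟨hx, hxB⟩)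
  refine ((hBf.image fj).union (Set.Finite.biUnion (Finset.range (P.card + 1)).finite_toSet
    (t := fun d => (fun t : ℝ => fj t) '' {x | x ∈ Set.Ico (0 : ℝ) 1 ∧ x ∉ P ∧ countLT P x = d})
    fun d hd => Set.Subsingleton.finite ?_)).subset ?_
  · clear hd
    rintro _ ⟨x, ⟨hx, hxP, rfl⟩, rfl⟩ _ ⟨y, ⟨hy, hyP, hxy⟩, rfl⟩
    wlog hle : x ≤ y generalizing x y
    · exact (this y hy hyP x hx hxP hxy.symm (le_of_not_ge hle)).symm
    exact (eq_of_locally_constant hB hle fun z hz => hmem z ⟨hx.1.trans hz.1, hz.2.trans_lt hy.2⟩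
      (notMem_of_countLT_eq hxP hyP hxy.symm hz)).symm
  · rintro _ ⟨x, rfl⟩
    obtain ⟨x, hx, rfl⟩ := AddCircle.eq_coe_Ico x
    by_cases hxP : x ∈ P
    · exact Or.inl ⟨x, ((finite_representatives hBf).mem_toFinset.1 hxP).2, rfl⟩
    · refine Or.inr (Set.mem_biUnion (x := countLT P x) ?_ ⟨x, ⟨hx, hxP, rfl⟩, rfl⟩)
      simpa using Nat.lt_succ_of_le (countLT_le P x)

/-! ### Linear growth of the Birkhoff sums. -/

/-- Every orbit of an irrational rotation visits a given nonempty open set in bounded time. -/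
theorem exists_nsmul_add_mem {α : ℝ} (hα : Irrational α) {E : Set UnitAddCircle} (hE : IsOpen E)
    (hne : E.Nonempty) : ∃ N : ℕ, 0 < N ∧ ∀ x : UnitAddCircle, ∃ i < N,
      x + i • (α : UnitAddCircle) ∈ E := by
  have hdense : DenseRange fun n : ℤ => n • (α : UnitAddCircle) :=
    AddCircle.denseRange_zsmul_coe_iff.2 (by simpa using hα)
  have hcov : (Set.univ : Set UnitAddCircle) ⊆
      ⋃ n : ℤ, (fun x => x + n • (α : UnitAddCircle)) ⁻¹' E := by
    intro x _
    obtain ⟨n, hn⟩ := hdense.exists_mem_open (hE.preimage (continuous_const_add x))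
      (hne.preimage (Homeomorph.addLeft x).surjective)
    exact Set.mem_iUnion.2 ⟨n, hn⟩
  obtain ⟨s, hs⟩ := isCompact_univ.elim_finite_subcover _
    (fun n => hE.preimage (continuous_add_const _)) hcov
  obtain ⟨M, hM⟩ : ∃ M : ℕ, ∀ n ∈ s, n.natAbs ≤ M :=
    ⟨s.sup Int.natAbs, fun n hn => Finset.le_sup (f := Int.natAbs) hn⟩
  refine ⟨2 * M + 1, by omega, fun x => ?_⟩
  obtain ⟨n, hn, hx⟩ := Set.mem_iUnion₂.1 (hs (Set.mem_univ (x + M • (α : UnitAddCircle))))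
  have := hM n hn
  refine ⟨(M + n).toNat, by omega, ?_⟩
  rw [Set.mem_preimage] at hx
  convert hx using 1
  rw [← natCast_zsmul, Int.toNat_of_nonneg (by omega), add_zsmul, natCast_zsmul, add_assoc]

/-- Birkhoff sums of a positive function which is bounded below on an open set grow linearly. -/
theorem exists_linear_le_sum {α : ℝ} (hα : Irrational α) {f : UnitAddCircle → ℝ}
    (hpos : ∀ x, 0 < f x) {E : Set UnitAddCircle} (hE : IsOpen E) (hne : E.Nonempty) {c₀ : ℝ}
    (hc₀ : 0 < c₀) (hf : ∀ x ∈ E, c₀ ≤ f x) :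
    ∃ c₁ > 0, ∃ c₂ : ℝ, ∀ (j : ℕ) (x : ℝ),
      c₁ * j - c₂ ≤ ∑ i ∈ Finset.range j, f ((x + i * α : ℝ)) := by
  obtain ⟨N, hN, hvisit⟩ := exists_nsmul_add_mem hα hE hne
  have hN' : (0 : ℝ) < N := by exact_mod_cast hN
  have h1 : ∀ x : ℝ, c₀ ≤ ∑ i ∈ Finset.range N, f ((x + i * α : ℝ)) := fun x => by
    obtain ⟨i, hi, hx⟩ := hvisit x
    rw [← AddCircle.coe_nsmul, nsmul_eq_mul, ← AddCircle.coe_add] at hx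
    exact (hf _ hx).trans (Finset.single_le_sum (f := fun i : ℕ => f ((x + i * α : ℝ)))
      (fun i _ => (hpos _).le) (Finset.mem_range.2 hi))
  have h2 : ∀ (k : ℕ) (x : ℝ), k * c₀ ≤ ∑ i ∈ Finset.range (N * k), f ((x + i * α : ℝ)) := by
    intro k
    induction k with
    | zero => simp
    | succ k ih =>
      intro x
      rw [Nat.mul_succ, Finset.sum_range_add]
      have := h1 (x + (N * k : ℕ) * α)
      have e : ∀ i : ℕ, x + (N * k : ℕ) * α + i * α = x + (N * k + i : ℕ) * α := fun i => by
        push_cast; ring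
      simp only [e] at this
      push_cast
      push_cast at ih this
      linarith [ih x]
  refine ⟨c₀ / N, by positivity, c₀, fun j x => ?_⟩
  have h3 : (j : ℝ) ≤ N * (j / N : ℕ) + N := by
    have := Nat.div_add_mod j N
    have := Nat.mod_lt j hN
    exact_mod_cast (by omega : j ≤ N * (j / N) + N)
  calc c₀ / N * j - c₀ ≤ c₀ / N * (N * (j / N : ℕ) + N) - c₀ := by gcongr
    _ = (j / N : ℕ) * c₀ := by field_simp; ring
    _ ≤ _ := h2 _ x
    _ ≤ _ := Finset.sum_le_sum_of_subset_of_nonneg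
        (Finset.range_mono (Nat.mul_div_le j N)) fun i _ _ => (hpos _).le

/-! ### Oscillation and slope of the sums of the roof on short arcs. -/

/-- The hypotheses on the roof function, with the set of points where the jump part may fail to be
locally constant, enlarged by `0`. -/
structure RoofData (D : QuasiSimilarData) (fa fj f : UnitAddCircle → ℝ) (St : ℝ)
    (B : Set UnitAddCircle) : Prop where
  ac : IsAbsolutelyContinuousOnCircle fa
  finite : B.Finite
  zero_mem : 0 ∈ B
  locally_constant : ∀ x ∉ B, ∀ᶠ y in 𝓝 x, fj y = fj x
  slope_pos : 0 < St
  eq : ∀ x, f x = fa x + fj x + D.cantorFun (circleFract x) + St * circleFract x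
  pos : ∀ x, 0 < f x

/-- The Birkhoff sums of `f` over the rotation by `α`, in real coordinates. -/
noncomputable def rotSum (α : ℝ) (f : UnitAddCircle → ℝ) (j : ℕ) (x : ℝ) : ℝ :=
  ∑ i ∈ Finset.range j, f ((x + i * α : ℝ))

namespace RoofData

variable {D : QuasiSimilarData} {fa fj f : UnitAddCircle → ℝ} {St : ℝ} {B : Set UnitAddCircle}
  {c α : ℝ}

theorem fract_eq (h : RoofData D fa fj f St B) {j : ℕ} {x y : ℝ} (hxy : x ≤ y)
    (hB : ∀ i < j, ∀ z ∈ Set.Icc x y, ((z + i * α : ℝ) : UnitAddCircle) ∉ B) {i : ℕ} (hi : i < j) :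
    Int.fract (y + i * α) = Int.fract (x + i * α) + (y - x) := by
  rw [fract_eq_fract_add_sub (x := x + i * α) (y := y + i * α) (by linarith) fun z hz e => ?_]
  · ring
  · refine hB i hi (z - i * α) ⟨by linarith [hz.1], by linarith [hz.2]⟩ ?_
    rw [sub_add_cancel, e]
    exact h.zero_mem

theorem rotSum_sub (h : RoofData D fa fj f St B) {j : ℕ} {x y : ℝ} (hxy : x ≤ y)
    (hB : ∀ i < j, ∀ z ∈ Set.Icc x y, ((z + i * α : ℝ) : UnitAddCircle) ∉ B) :
    rotSum α f j y - rotSum α f j x =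
      ∑ i ∈ Finset.range j, (fa ((y + i * α : ℝ)) - fa ((x + i * α : ℝ))) +
      ∑ i ∈ Finset.range j,
        (D.cantorFun (Int.fract (y + i * α)) - D.cantorFun (Int.fract (x + i * α))) +
      j * (St * (y - x)) := by
  have e : (j : ℝ) * (St * (y - x)) = ∑ i ∈ Finset.range j, St * (y - x) := by simp
  rw [rotSum, rotSum, ← Finset.sum_sub_distrib, e, ← Finset.sum_add_distrib,
    ← Finset.sum_add_distrib]
  refine Finset.sum_congr rfl fun i hi => ?_
  have hi := Finset.mem_range.1 hi
  have hj : fj ((y + i * α : ℝ)) = fj ((x + i * α : ℝ)) := by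
    refine eq_of_locally_constant h.locally_constant (by linarith) fun z hz => ?_
    have := hB i hi (z - i * α) ⟨by linarith [hz.1], by linarith [hz.2]⟩
    rwa [sub_add_cancel] at this
  rw [h.eq, h.eq, hj]
  simp only [circleFract_coe]
  linear_combination St * h.fract_eq hxy hB hi

/-- Disjoint translates bound the three contributions separately: total variation of `fa`, total
increase of the Cantor function, and `St * c` from the linear part. -/
theorem exists_abs_rotSum_sub_le (h : RoofData D fa fj f St B) (hα : BadlyApproximable c α) :
    ∃ V : ℝ, ∀ n j : ℕ, j ≤ n → ∀ x y : ℝ, x ≤ y → y - x ≤ c / n →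
      (∀ i < j, ∀ z ∈ Set.Icc x y, ((z + i * α : ℝ) : UnitAddCircle) ∉ B) →
      |rotSum α f j y - rotSum α f j x| ≤ V := by
  have hmono := D.monotone_cantorFun
  refine ⟨(∫ t in (0 : ℝ)..1, |deriv (fun t : ℝ => fa t) t|) +
    (D.cantorFun 1 - D.cantorFun 0) + St * c, fun n j hj x y hxy hc hB => ?_⟩
  have hf : ∀ i < j, Int.fract (y + i * α) = Int.fract (x + i * α) + (y - x) :=
    fun i hi => h.fract_eq hxy hB hi
  have hle : ∀ i ∈ Finset.range j, Int.fract (x + i * α) ≤ Int.fract (y + i * α) := fun i hi => by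
    linarith [hf i (Finset.mem_range.1 hi)]
  have h1 := abs_sum_sub_le hα h.ac hj hxy hc hf
  have h2 := sum_sub_le_of_pairwiseDisjoint hmono D.continuous_cantorFun hle
    (fun i _ => Int.fract_nonneg _) (fun i _ => (Int.fract_lt_one _).le)
    (hα.pairwiseDisjoint hj hc hf)
  have h3 : 0 ≤ ∑ i ∈ Finset.range j,
      (D.cantorFun (Int.fract (y + i * α)) - D.cantorFun (Int.fract (x + i * α))) :=
    Finset.sum_nonneg fun i hi => sub_nonneg.2 (hmono (hle i hi))
  have h4 : (j : ℝ) * (St * (y - x)) ≤ St * c := by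
    have hjc : (j : ℝ) * (y - x) ≤ c := by
      rcases Nat.eq_zero_or_pos n with rfl | hn
      · simp [Nat.le_zero.1 hj, hα.1.le]
      · have hn' : (0 : ℝ) < n := by exact_mod_cast hn
        calc (j : ℝ) * (y - x) ≤ n * (c / n) := by
              gcongr
          _ = c := by field_simp
    calc (j : ℝ) * (St * (y - x)) = St * (j * (y - x)) := by ring
      _ ≤ _ := mul_le_mul_of_nonneg_left hjc h.slope_pos.le
  have h5 : 0 ≤ (j : ℝ) * (St * (y - x)) :=
    mul_nonneg j.cast_nonneg (mul_nonneg h.slope_pos.le (sub_nonneg.2 hxy))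
  rw [h.rotSum_sub hxy hB]
  rw [abs_le] at h1 ⊢
  constructor <;> linarith [h1.1, h1.2]

theorem exists_le_rotSum_sub (h : RoofData D fa fj f St B) (hα : BadlyApproximable c α)
    (hirr : Irrational α) {ε : ℝ} (hε : 0 < ε) :
    ∃ K : ℝ, ∀ n j : ℕ, j ≤ n → K ≤ j → ∀ x y : ℝ, x ≤ y → y - x ≤ c / n →
      (∀ i < j, ∀ z ∈ Set.Icc x y, ((z + i * α : ℝ) : UnitAddCircle) ∉ B) →
      j * St / 2 * (y - x) - ε ≤ rotSum α f j y - rotSum α f j x := by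
  have hS := h.slope_pos
  -- Once `K ≤ j * St / 4`, the absolutely continuous part costs at most half of the slope `j * St`.
  obtain ⟨K, hK⟩ := exists_le_sum_sub hα hirr h.ac (lt_min hε (by positivity : 0 < St / 4))
  refine ⟨K / (St / 4), fun n j hj hKj x y hxy hc hB => ?_⟩
  have hf : ∀ i < j, Int.fract (y + i * α) = Int.fract (x + i * α) + (y - x) :=
    fun i hi => h.fract_eq hxy hB hi
  have h1 := hK n j hj x y hxy hc hf
  have h3 : 0 ≤ ∑ i ∈ Finset.range j,
      (D.cantorFun (Int.fract (y + i * α)) - D.cantorFun (Int.fract (x + i * α))) :=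
    Finset.sum_nonneg fun i hi => sub_nonneg.2 (D.monotone_cantorFun (by
      linarith [hf i (Finset.mem_range.1 hi)]))
  rw [h.rotSum_sub hxy hB]
  rw [div_le_iff₀ (by positivity)] at hKj
  have h4 : (j * min ε (St / 4) + K) * (y - x) ≤ (j * (St / 4) + j * (St / 4)) * (y - x) := by
    gcongr
    exact min_le_right _ _
  linarith [min_le_left ε (St / 4)]

end RoofData

/-! ### Covering by cells and the measure estimate. -/

/-- Sending a bad point to the element of `B` that it hits is injective: with equal indices two bad
points differ by an integer of modulus less than one, and with distinct indices the orbit separation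
exceeds their distance. -/
theorem exists_bad_points {c α : ℝ} (hα : BadlyApproximable c α) {B : Set UnitAddCircle}
    (hB : B.Finite) {n : ℕ} {l r : ℝ} (hr : r ≤ c / n) (hr1 : r ≤ 1) :
    ∃ P : Finset ℝ, P.card ≤ B.ncard ∧ ∀ z ∈ Set.Ioc l (l + r), ∀ i < n,
      ((z + i * α : ℝ) : UnitAddCircle) ∈ B → z ∈ P := by
  set S : Set ℝ := {z | z ∈ Set.Ioc l (l + r) ∧ ∃ i < n, ((z + i * α : ℝ) : UnitAddCircle) ∈ B}
    with hS
  have hch : ∀ z : ℝ, ∃ i : ℕ, z ∈ S → i < n ∧ ((z + i * α : ℝ) : UnitAddCircle) ∈ B := fun z => by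
    by_cases hz : z ∈ S
    · obtain ⟨i, hi⟩ := hz.2
      exact ⟨i, fun _ => hi⟩
    · exact ⟨0, fun h => absurd h hz⟩
  choose ι hι using hch
  have hmaps : Set.MapsTo (fun z => ((z + ι z * α : ℝ) : UnitAddCircle)) S B := fun z hz =>
    (hι z hz).2
  have hinj : Set.InjOn (fun z => ((z + ι z * α : ℝ) : UnitAddCircle)) S := by
    intro z hz w hw e
    simp only at e
    rw [← sub_eq_zero, ← AddCircle.coe_sub, AddCircle.coe_eq_zero_iff] at e
    obtain ⟨k, hk⟩ := e
    rw [zsmul_one] at hk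
    have habs : |z - w| < r := by
      rw [abs_lt]
      constructor <;> linarith [hz.1.1, hz.1.2, hw.1.1, hw.1.2]
    by_cases hik : ι z = ι w
    · rw [hik] at hk
      have hk' : z - w = k := by linarith
      rw [hk'] at habs
      have : |k| < 1 := by exact_mod_cast habs.trans_le hr1
      rw [Int.abs_lt_one_iff.1 this] at hk'
      simpa [sub_eq_zero] using hk'
    · have := hα.div_le_abs (hι z hz).1 (hι w hw).1 hik k
      have e2 : ι z * α - ι w * α - k = -(z - w) := by linarith
      rw [e2, abs_neg] at this
      linarith
  have hfin : S.Finite := Set.Finite.of_injOn hmaps hinj hB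
  refine ⟨hfin.toFinset, ?_, fun z hz i hi hzB => hfin.mem_toFinset.2 ⟨hz, i, hi, hzB⟩⟩
  rw [← Set.ncard_eq_toFinset_card S hfin]
  exact Set.ncard_le_ncard_of_injOn _ hmaps hinj hB

/-- The measure bound on a cell where all the functions `F j` increase steeply and oscillate
little. -/
theorem volume_cell_le {E : Set ℝ} {F : ℕ → ℝ → ℝ} {t ε V c₁ c₂ s : ℝ} {L : ℕ} {J : ℕ → Prop}
    (hε1 : ε ≤ 1) (hc₁ : 0 < c₁) (hs : 0 < s) (hL : (2 + V + c₂) / c₁ ≤ L)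
    (hJ : ∀ x ∈ E, ∀ j, |F j x - t| < ε → J j)
    (hV : ∀ x ∈ E, ∀ y ∈ E, ∀ j, J j → F j y - F j x ≤ V)
    (hgrow : ∀ x, ∀ j k : ℕ, j ≤ k → c₁ * ((k : ℝ) - j) - c₂ ≤ F k x - F j x)
    (hslope : ∀ x ∈ E, ∀ y ∈ E, x ≤ y → ∀ j, J j → s * (y - x) - ε ≤ F j y - F j x) :
    volume (E ∩ {x | ∃ j, |F j x - t| < ε}) ≤ (L + 1 : ℕ) * ENNReal.ofReal (3 * ε / s) := by
  set R : Set ℕ := {j | ∃ x ∈ E, |F j x - t| < ε} with hR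
  rcases R.eq_empty_or_nonempty with hempty | hne
  · have : E ∩ {x | ∃ j, |F j x - t| < ε} = ∅ := by
      rw [Set.eq_empty_iff_forall_notMem]
      rintro x ⟨hx, j, hj⟩
      exact (hempty ▸ (⟨x, hx, hj⟩ : j ∈ R) : j ∈ (∅ : Set ℕ))
    rw [this]
    simp
  obtain ⟨x₀, hx₀, hj₀⟩ : sInf R ∈ R := Nat.sInf_mem hne
  set j₀ := sInf R
  -- Compare any relevant `k` with the least one `j₀` at the single point `x₀`: growth from `j₀` to
  -- `k` is at most `2 * ε + V`, so `k - j₀ ≤ L`.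
  have hcov : E ∩ {x | ∃ j, |F j x - t| < ε} ⊆
      ⋃ j ∈ Finset.Icc j₀ (j₀ + L), E ∩ {x | |F j x - t| < ε} := by
    rintro x ⟨hx, k, hk⟩
    have hle : j₀ ≤ k := Nat.sInf_le ⟨x, hx, hk⟩
    refine Set.mem_biUnion (x := k) ?_ ⟨hx, hk⟩
    simp only [Finset.coe_Icc, Set.mem_Icc]
    refine ⟨hle, ?_⟩
    have h1 := hgrow x₀ j₀ k hle
    have h2 := hV x hx x₀ hx₀ k (hJ x hx k hk)
    rw [abs_lt] at hk hj₀
    have h3 : c₁ * ((k : ℝ) - j₀) ≤ 2 + V + c₂ := by linarith [hk.2, hj₀.1]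
    have h4 : (k : ℝ) - j₀ ≤ L := by
      refine le_trans ?_ hL
      rw [le_div_iff₀ hc₁]
      linarith
    exact_mod_cast (by linarith : (k : ℝ) ≤ j₀ + L)
  -- Values within `2 * ε` of each other, plus the slack `ε` in the slope bound, give `3 * ε`.
  have hone : ∀ j, volume (E ∩ {x | |F j x - t| < ε}) ≤ ENNReal.ofReal (3 * ε / s) := by
    intro j
    refine (Real.volume_le_diam _).trans (Metric.ediam_le ?_)
    rintro x ⟨hx, hxj⟩ y ⟨hy, hyj⟩
    wlog hxy : x ≤ y generalizing x y
    · rw [edist_comm]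
      exact this y hy hyj x hx hxj (le_of_not_ge hxy)
    rw [edist_dist, dist_comm, Real.dist_eq, abs_of_nonneg (sub_nonneg.2 hxy)]
    refine ENNReal.ofReal_le_ofReal ?_
    rw [le_div_iff₀ hs]
    have h1 := hslope x hx y hy hxy j (hJ x hx j hxj)
    have h2 : -ε < F j x - t ∧ F j x - t < ε := abs_lt.1 hxj
    have h3 : -ε < F j y - t ∧ F j y - t < ε := abs_lt.1 hyj
    linarith [h2.1, h3.2]
  calc _ ≤ ∑ j ∈ Finset.Icc j₀ (j₀ + L), volume (E ∩ {x | |F j x - t| < ε}) :=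
        (measure_mono hcov).trans (measure_biUnion_finset_le _ _)
    _ ≤ ∑ j ∈ Finset.Icc j₀ (j₀ + L), ENNReal.ofReal (3 * ε / s) :=
        Finset.sum_le_sum fun j _ => hone j
    _ = _ := by
        rw [Finset.sum_const, Nat.card_Icc, nsmul_eq_mul]
        congr 2
        omega

theorem volume_interval_le {l r : ℝ} {P : Finset ℝ} {N : ℕ} {X : Set ℝ} {b : ENNReal}
    (hP : P.card ≤ N)
    (h : ∀ d, volume ({x | x ∈ Set.Ioc l (l + r) ∧ x ∉ P ∧ countLT P x = d} ∩ X) ≤ b) :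
    volume (Set.Ioc l (l + r) ∩ X) ≤ (N + 1 : ℕ) * b := by
  have hcov : Set.Ioc l (l + r) ∩ X ⊆ (⋃ d ∈ Finset.range (N + 1),
      {x | x ∈ Set.Ioc l (l + r) ∧ x ∉ P ∧ countLT P x = d} ∩ X) ∪ (P : Set ℝ) := by
    rintro x ⟨hx, hxX⟩
    by_cases hxP : x ∈ P
    · exact Or.inr hxP
    · refine Or.inl (Set.mem_biUnion (x := countLT P x) ?_ ⟨⟨hx, hxP, rfl⟩, hxX⟩)
      simpa using Nat.lt_succ_of_le ((countLT_le P x).trans hP)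
  calc _ ≤ volume (⋃ d ∈ Finset.range (N + 1),
        {x | x ∈ Set.Ioc l (l + r) ∧ x ∉ P ∧ countLT P x = d} ∩ X) + volume (P : Set ℝ) :=
        (measure_mono hcov).trans (measure_union_le _ _)
    _ ≤ ∑ d ∈ Finset.range (N + 1), b + 0 := by
        refine add_le_add ?_ (P.finite_toSet.measure_zero _).le
        exact (measure_biUnion_finset_le _ _).trans (Finset.sum_le_sum fun d _ => h d)
    _ = _ := by simp

namespace RoofData

variable {D : QuasiSimilarData} {fa fj f : UnitAddCircle → ℝ} {St : ℝ} {B : Set UnitAddCircle}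
  {c α : ℝ}

theorem exists_bound (h : RoofData D fa fj f St B) : ∃ M : ℝ, 0 < M ∧ ∀ x, f x ≤ M := by
  obtain ⟨C, hC⟩ := AbsolutelyContinuousOnInterval.exists_bound h.ac
  have hj : IsFiniteJumpFunction fj := ⟨B, h.finite, h.locally_constant⟩
  obtain ⟨C', hC'⟩ := hj.finite_range.bddAbove
  have hle : ∀ x, f x ≤ C + C' + D.cantorFun 1 + St := fun x => by
    obtain ⟨x, hx, rfl⟩ := AddCircle.eq_coe_Ico x
    rw [h.eq, circleFract_coe]
    have h1 : fa x ≤ C := (le_abs_self _).trans (hC x (by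
      rw [Set.uIcc_of_le zero_le_one]
      exact Set.Ico_subset_Icc_self hx))
    have h2 : fj x ≤ C' := hC' ⟨_, rfl⟩
    have h3 : D.cantorFun (Int.fract x) ≤ D.cantorFun 1 :=
      D.monotone_cantorFun (Int.fract_lt_one x).le
    have h4 : St * Int.fract x ≤ St := by
      have := h.slope_pos
      nlinarith [Int.fract_lt_one x]
    linarith
  exact ⟨_, (h.pos 0).trans_le (hle 0), hle⟩

/-- The roof is continuous at points of `(0, 1)` off `B`, so positivity at one such point persists
nearby; this local bound replaces a global positive lower bound. -/
theorem exists_isOpen_le (h : RoofData D fa fj f St B) :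
    ∃ E : Set UnitAddCircle, IsOpen E ∧ E.Nonempty ∧ ∃ c₀ > 0, ∀ x ∈ E, c₀ ≤ f x := by
  obtain ⟨r, hr, hrP⟩ : ∃ r ∈ Set.Ioo (0 : ℝ) 1, (r : UnitAddCircle) ∉ B := by
    by_contra! hcon
    exact (Set.Ioo_infinite (zero_lt_one' ℝ)) ((finite_representatives h.finite).subset
      fun x hx => ⟨Set.Ioo_subset_Ico_self hx, hcon x hx⟩)
  have hcoe : ContinuousAt (fun t : ℝ => (t : UnitAddCircle)) r :=
    (AddCircle.continuous_mk' 1).continuousAt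
  have h1 : ContinuousAt (fun t : ℝ => fa t) r := by
    refine (AbsolutelyContinuousOnInterval.continuousOn h.ac).continuousAt ?_
    rw [Set.uIcc_of_le zero_le_one]
    exact Icc_mem_nhds hr.1 hr.2
  have h2 : ContinuousAt (fun t : ℝ => fj t) r := by
    refine ContinuousAt.congr (f := fun _ => fj r) continuousAt_const ?_
    filter_upwards [hcoe.eventually (h.locally_constant r hrP)] with t ht using ht.symm
  have h3 : ContinuousAt (fun t : ℝ => D.cantorFun t) r := D.continuous_cantorFun.continuousAt
  have hF : ContinuousAt (fun t : ℝ => f t) r := by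
    refine ((h1.add h2).add h3 |>.add (continuousAt_const.mul continuousAt_id (x := r)
      (f := fun _ => St))).congr ?_
    filter_upwards [Ioo_mem_nhds hr.1 hr.2] with t ht
    rw [h.eq, circleFract_coe, Int.fract_eq_self.2 ⟨ht.1.le, ht.2⟩]
    rfl
  have hpos := h.pos r
  obtain ⟨U, hU, hUo, hrU⟩ := mem_nhds_iff.1
    (hF.eventually (lt_mem_nhds (half_lt_self hpos)))
  refine ⟨(fun t : ℝ => (t : UnitAddCircle)) '' U, QuotientAddGroup.isOpenMap_coe U hUo,
    ⟨_, r, hrU, rfl⟩, f r / 2, half_pos hpos, ?_⟩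
  rintro _ ⟨t, ht, rfl⟩
  exact (hU ht).le

theorem volume_le (h : RoofData D fa fj f St B) (hα : BadlyApproximable c α)
    (hirr : Irrational α) :
    ∃ C : ℝ, 0 < C ∧ ∀ ε : ℝ, 0 < ε → ε ≤ 1 → ∃ t₀ : ℝ, ∀ t ≥ t₀,
      volume {x : ℝ | x ∈ Set.Ioc 0 1 ∧ ∃ j, |rotSum α f j x - t| < ε} ≤
        ENNReal.ofReal (C * ε) := by
  have hS := h.slope_pos
  have hc := hα.1
  obtain ⟨M, hM, hfM⟩ := h.exists_bound
  obtain ⟨E, hE, hEne, c₀, hc₀, hfE⟩ := h.exists_isOpen_le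
  obtain ⟨c₁, hc₁, c₂, hlin⟩ := exists_linear_le_sum hirr h.pos hE hEne hc₀ hfE
  have hc₂ : 0 ≤ c₂ := by simpa using hlin 0 0
  obtain ⟨V, hV⟩ := h.exists_abs_rotSum_sub_le hα
  obtain ⟨L, hL⟩ := exists_nat_ge ((2 + V + c₂) / c₁)
  set κ : ℝ := c₁ / (2 * M) with hκ
  have hκ0 : 0 < κ := by positivity
  set N := B.ncard with hN
  have hgrow : ∀ x : ℝ, ∀ j k : ℕ, j ≤ k →
      c₁ * ((k : ℝ) - j) - c₂ ≤ rotSum α f k x - rotSum α f j x := by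
    intro x j k hjk
    obtain ⟨m, rfl⟩ := Nat.exists_eq_add_of_le hjk
    have := hlin m (x + j * α)
    rw [rotSum, rotSum, Finset.sum_range_add, add_sub_cancel_left]
    push_cast
    rw [add_sub_cancel_left]
    refine this.trans (le_of_eq (Finset.sum_congr rfl fun i _ => ?_))
    congr 2
    ring
  have hupper : ∀ (j : ℕ) (x : ℝ), rotSum α f j x ≤ j * M := fun j x =>
    (Finset.sum_le_sum fun i _ => hfM _).trans (by simp)
  -- The factors count arcs per `n`, cells per arc and times per cell; the last is `3 / s` with `s =
  -- St * κ * n / 2`, whose `n` cancels the number of arcs.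
  refine ⟨(1 / c + 2) * (N + 1) * (L + 1) * (6 / (St * κ)), by positivity, fun ε hε hε1 => ?_⟩
  obtain ⟨K, hK⟩ := h.exists_le_rotSum_sub hα hirr hε
  -- The first bound makes `t - 1` at least half of `t + 1 + c₂ + c₁`, giving `κ * n ≤ j`; the
  -- second gives `K ≤ κ * n`. Only this threshold depends on `ε`.
  refine ⟨max (3 + c₂ + c₁) (K * c₁ / κ), fun t ht => ?_⟩
  have ht1 : 3 + c₂ + c₁ ≤ t := (le_max_left _ _).trans ht
  have ht2 : K * c₁ / κ ≤ t := (le_max_right _ _).trans ht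
  set n := ⌈(t + 1 + c₂) / c₁⌉₊ with hn
  have hn_ge : (t + 1 + c₂) / c₁ ≤ n := Nat.le_ceil _
  have hn_lt : (n : ℝ) < (t + 1 + c₂) / c₁ + 1 := Nat.ceil_lt_add_one (by
    apply div_nonneg _ hc₁.le
    linarith)
  have hn1 : 1 ≤ n := Nat.ceil_pos.2 (by apply div_pos _ hc₁; linarith)
  have hn1' : (1 : ℝ) ≤ n := by exact_mod_cast hn1
  have hJ : ∀ (x : ℝ) (j : ℕ), |rotSum α f j x - t| < ε → κ * n ≤ j ∧ j ≤ n := by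
    intro x j hj
    have hj' := abs_lt.1 hj
    constructor
    · have h1 := hupper j x
      have h2 : (n : ℝ) ≤ (t + 1 + c₂ + c₁) / c₁ := by
        rw [add_div _ c₁, div_self hc₁.ne']
        exact hn_lt.le
      calc κ * n ≤ κ * ((t + 1 + c₂ + c₁) / c₁) := by gcongr
        _ = (t + 1 + c₂ + c₁) / 2 / M := by rw [hκ]; field_simp
        _ ≤ j := by
          rw [div_le_iff₀ hM]
          linarith
    · have h1 := hlin j x
      rw [← rotSum] at h1
      have h2 : (j : ℝ) ≤ (t + 1 + c₂) / c₁ := by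
        rw [le_div_iff₀ hc₁]
        linarith
      exact_mod_cast h2.trans hn_ge
  have hKn : K ≤ κ * n := by
    rw [div_le_iff₀ hκ0] at ht2
    have : t ≤ c₁ * n := by
      rw [div_le_iff₀ hc₁] at hn_ge
      linarith
    have h3 : K * c₁ ≤ κ * n * c₁ := by nlinarith
    exact le_of_mul_le_mul_right h3 hc₁
  set s : ℝ := St * (κ * n) / 2 with hs
  have hs0 : 0 < s := by positivity
  -- The number of arcs: large enough for length at most `c / n`, yet still linear in `n`.
  obtain ⟨m, hm1, hm2⟩ : ∃ m : ℕ, n / c ≤ m ∧ (m : ℝ) ≤ n * (1 / c + 2) ∧ 1 ≤ m := by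
    refine ⟨⌈n / c⌉₊ + 1, ?_, ?_, by omega⟩
    · push_cast
      linarith [Nat.le_ceil ((n : ℝ) / c)]
    · have := Nat.ceil_lt_add_one (a := (n : ℝ) / c) (by positivity)
      push_cast
      have e : (n : ℝ) * (1 / c + 2) = n / c + 2 * n := by ring
      rw [e]
      linarith
  have hm0 : (0 : ℝ) < m := by exact_mod_cast hm2.2
  have hr : (1 : ℝ) / m ≤ c / n := by
    rw [div_le_div_iff₀ hm0 (by linarith)]
    rw [div_le_iff₀ hc] at hm1
    linarith
  have hr1 : (1 : ℝ) / m ≤ 1 := by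
    rw [div_le_one hm0]
    exact_mod_cast hm2.2
  set X : Set ℝ := {x | ∃ j, |rotSum α f j x - t| < ε} with hX
  have hint : ∀ l : ℝ, volume (Set.Ioc l (l + 1 / m) ∩ X) ≤
      (N + 1 : ℕ) * ((L + 1 : ℕ) * ENNReal.ofReal (3 * ε / s)) := by
    intro l
    obtain ⟨P, hP, hbad⟩ := exists_bad_points hα h.finite (l := l) hr hr1
    refine volume_interval_le hP fun d => ?_
    have hlen : ∀ {x y : ℝ}, x ∈ Set.Ioc l (l + 1 / m) → y ∈ Set.Ioc l (l + 1 / m) →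
        y - x ≤ c / n := fun {x y} hx hy => by linarith [hx.1, hy.2]
    have hgood : ∀ {x y : ℝ}, x ∈ {x | x ∈ Set.Ioc l (l + 1 / m) ∧ x ∉ P ∧ countLT P x = d} →
        y ∈ {x | x ∈ Set.Ioc l (l + 1 / m) ∧ x ∉ P ∧ countLT P x = d} → ∀ {j : ℕ}, j ≤ n →
        ∀ i < j, ∀ z ∈ Set.Icc x y, ((z + i * α : ℝ) : UnitAddCircle) ∉ B := by
      intro x y hx hy j hj i hi z hz hzB
      exact notMem_of_countLT_eq hx.2.1 hy.2.1 (hx.2.2.trans hy.2.2.symm) hz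
        (hbad z ⟨hx.1.1.trans_le hz.1, hz.2.trans hy.1.2⟩ i (hi.trans_le hj) hzB)
    refine volume_cell_le (J := fun j => κ * n ≤ j ∧ j ≤ n) hε1 hc₁ hs0 hL
      (fun x _ j hj => hJ x j hj) (fun x hx y hy j hj => ?_) hgrow
      (fun x hx y hy hxy j hj => ?_)
    · rcases le_total x y with hxy | hxy
      · exact (le_abs_self _).trans (hV n j hj.2 x y hxy (hlen hx.1 hy.1) (hgood hx hy hj.2))
      · rw [← neg_sub]
        exact (neg_le_abs _).trans (hV n j hj.2 y x hxy (hlen hy.1 hx.1) (hgood hy hx hj.2))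
    · refine le_trans ?_ (hK n j hj.2 (hKn.trans hj.1) x y hxy (hlen hx.1 hy.1) (hgood hx hy hj.2))
      have : s ≤ j * St / 2 := by
        rw [hs]
        nlinarith [hj.1]
      nlinarith
  have hcov : {x : ℝ | x ∈ Set.Ioc 0 1 ∧ ∃ j, |rotSum α f j x - t| < ε} ⊆
      ⋃ k ∈ Finset.range m, Set.Ioc ((k : ℝ) / m) (k / m + 1 / m) ∩ X := by
    rintro x ⟨hx, hxX⟩
    have hpos : 0 < ⌈x * m⌉₊ := Nat.ceil_pos.2 (mul_pos hx.1 hm0)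
    obtain ⟨k, hk⟩ : ∃ k, ⌈x * m⌉₊ = k + 1 := ⟨_, (Nat.succ_pred_eq_of_pos hpos).symm⟩
    have h1 : x * m ≤ k + 1 := by
      have := Nat.le_ceil (x * m)
      rw [hk] at this
      exact_mod_cast this
    have h2 : (k : ℝ) < x * m := Nat.lt_ceil.1 (by omega)
    refine Set.mem_biUnion (x := k) ?_ ⟨⟨?_, ?_⟩, hxX⟩
    · have : (k : ℝ) < m := h2.trans_le (by nlinarith [hx.2])
      simpa using this
    · rwa [div_lt_iff₀ hm0]
    · rwa [← add_div, le_div_iff₀ hm0]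
  calc _ ≤ ∑ k ∈ Finset.range m, (((N + 1 : ℕ) : ENNReal) *
        (((L + 1 : ℕ) : ENNReal) * ENNReal.ofReal (3 * ε / s))) :=
        (measure_mono hcov).trans ((measure_biUnion_finset_le _ _).trans
          (Finset.sum_le_sum fun k _ => hint _))
    _ = ENNReal.ofReal (m * ((N + 1 : ℕ) * ((L + 1 : ℕ) * (3 * ε / s)))) := by
        rw [ENNReal.ofReal_mul m.cast_nonneg, ENNReal.ofReal_mul (Nat.cast_nonneg _),
          ENNReal.ofReal_mul (Nat.cast_nonneg _)]
        simp only [Finset.sum_const, Finset.card_range, nsmul_eq_mul, ENNReal.ofReal_natCast]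
    _ ≤ _ := by
        refine ENNReal.ofReal_le_ofReal ?_
        push_cast
        calc (m : ℝ) * ((N + 1) * ((L + 1) * (3 * ε / s)))
            ≤ (n * (1 / c + 2)) * ((N + 1) * ((L + 1) * (3 * ε / s))) := by
              gcongr
              exact hm2.1
          _ = _ := by
              rw [hs]
              field_simp
              ring

end RoofData

/-! ### From the flow to Birkhoff sums, and the contradiction. -/

theorem birkhoffSum_circleRotation (α : ℝ) (f : UnitAddCircle → ℝ) (j : ℕ) (x : ℝ) :
    birkhoffSum (circleRotation α) f j x = rotSum α f j x := by
  have hit : ∀ i : ℕ, (circleRotation α)^[i] (x : UnitAddCircle) = ((x + i * α : ℝ)) := by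
    intro i
    induction i with
    | zero => simp
    | succ i ih =>
      rw [Function.iterate_succ_apply', ih, circleRotation, Equiv.coe_addRight]
      beta_reduce
      rw [← AddCircle.coe_add]
      congr 1
      push_cast
      ring
  simp [birkhoffSum, rotSum, hit]

/-- The measure of a subset of the circle is at most that of its representatives in `(0, 1]`. -/
theorem volume_le_volume_representatives (G : Set UnitAddCircle) :
    volume G ≤ volume {x : ℝ | x ∈ Set.Ioc 0 1 ∧ (x : UnitAddCircle) ∈ G} := by
  -- Measurability of `G` is not available; for a measurable equivalence the preimage formula holds
  -- for arbitrary sets.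
  have hmp : MeasurePreserving (AddCircle.measurableEquivIoc 1 0)
      (volume : Measure UnitAddCircle) (Measure.comap Subtype.val volume) :=
    AddCircle.measurePreserving_equivIoc 1
  set S : Set (Set.Ioc (0 : ℝ) (0 + 1)) := {y | ((y : ℝ) : UnitAddCircle) ∈ G} with hS
  have e : G = AddCircle.measurableEquivIoc 1 0 ⁻¹' S := by
    ext x
    simp only [hS, Set.mem_preimage]
    change x ∈ G ↔ (((AddCircle.equivIoc 1 0 x : Set.Ioc (0 : ℝ) (0 + 1)) : ℝ) : UnitAddCircle) ∈ G
    rw [AddCircle.coe_equivIoc]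
  rw [e, hmp.measure_preimage_equiv, (MeasurableEmbedding.subtype_coe
    measurableSet_Ioc).comap_apply, ← e]
  refine measure_mono ?_
  rintro _ ⟨y, hy, rfl⟩
  exact ⟨by simpa using y.2, hy⟩

/-- If a special flow moves a point at height less than `ε` over a positive roof to a point at
height less than `ε`, then the time is close to a Birkhoff sum of the roof. -/
theorem exists_abs_birkhoffSum_sub_lt {X : Type*} {T : X ≃ X} {f : X → ℝ} (hpos : ∀ x, 0 < f x)
    {ε t : ℝ} (hεt : ε < t) {x : X} {s : ℝ} (hs : s ∈ Set.Ico 0 ε)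
    (h : (specialFlow T f t (x, s)).2 ∈ Set.Ico 0 ε) :
    ∃ j : ℕ, |birkhoffSum T f j x - t| < ε := by
  simp only [specialFlow] at h
  set n := specialIndex T f x (s + t)
  rcases hn : n with j | j
  · rw [hn] at h
    simp only [cocycleSum] at h
    exact ⟨j, abs_lt.2 ⟨by linarith [h.2, hs.1], by linarith [h.1, hs.2]⟩⟩
  -- A negative index would put the image at height at least `t`, above `ε`.
  · rw [hn] at h
    simp only [cocycleSum] at h
    have : 0 ≤ birkhoffSum T f (j + 1) (T.symm^[j + 1] x) :=
      Finset.sum_nonneg fun i _ => (hpos _).le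
    linarith [h.2, hs.1]

theorem mainTheorem5 (α : ℝ) (hα : Irrational α) (hbdd : HasBoundedPartialQuotients α)
    (D : QuasiSimilarData) (fa fj fs f : UnitAddCircle → ℝ)
    (hfa : IsAbsolutelyContinuousOnCircle fa) (hfj : IsFiniteJumpFunction fj)
    (hfs : ∀ x, fs x = D.cantorFun (circleFract x))
    (St : ℝ) (hSt : 0 < St)
    (hf : ∀ x, f x = fa x + fj x + fs x + St * circleFract x)
    (hpos : ∀ x, 0 < f x) :
    ¬ IsPartiallyRigid (specialMeasure (volume : Measure UnitAddCircle) f)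
      (specialFlow (circleRotation α) f) := by
  rintro ⟨u, hu0, -, τ, hτ, hrig⟩
  obtain ⟨c, hc⟩ := hbdd.exists_le_mul_abs_sub hα
  obtain ⟨B, hBf, hB⟩ := hfj
  -- The point `0` joins the singular set because the fractional part and the Cantor part jump
  -- there.
  have h : RoofData D fa fj f St (insert 0 B) :=
    { ac := hfa
      finite := hBf.insert 0
      zero_mem := Set.mem_insert _ _
      locally_constant := fun x hx => hB x fun hxB => hx (Set.mem_insert_of_mem _ hxB)
      slope_pos := hSt
      eq := fun x => by rw [hf, hfs]
      pos := hpos }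
  obtain ⟨C, hC0, hC⟩ := h.volume_le hc hα
  obtain ⟨E, hE, hEne, c₀, hc₀, hfE⟩ := h.exists_isOpen_le
  have huE : u * volume E ≠ 0 := mul_ne_zero hu0.ne' (hE.measure_pos volume hEne).ne'
  obtain ⟨ε, hε0, hεE, hεc, hε1⟩ : ∃ ε : ℝ, 0 < ε ∧ ENNReal.ofReal (C * ε) < u * volume E ∧
      ε ≤ c₀ ∧ ε ≤ 1 := by
    have hlim : Tendsto (fun ε : ℝ => ENNReal.ofReal (C * ε)) (𝓝[>] 0) (𝓝 0) := by
      have : Tendsto (fun ε : ℝ => ENNReal.ofReal (C * ε)) (𝓝 0) (𝓝 (ENNReal.ofReal (C * 0))) :=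
        (ENNReal.continuous_ofReal.comp (continuous_const_mul C)).tendsto 0
      rw [mul_zero, ENNReal.ofReal_zero] at this
      exact this.mono_left nhdsWithin_le_nhds
    obtain ⟨ε, h1, h2, h3⟩ := ((hlim.eventually (gt_mem_nhds (pos_iff_ne_zero.2 huE))).and
      (Ioc_mem_nhdsGT (lt_min hc₀ one_pos))).exists
    exact ⟨ε, h2, h1, h3.trans (min_le_left _ _), h3.trans (min_le_right _ _)⟩
  obtain ⟨t₀, ht₀⟩ := hC ε hε0 hε1
  have hAm : MeasurableSet (E ×ˢ Set.Ico 0 ε) := hE.measurableSet.prod measurableSet_Ico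
  have hA : specialMeasure volume f (E ×ˢ Set.Ico 0 ε) = volume E * ENNReal.ofReal ε := by
    rw [specialMeasure, Measure.restrict_apply hAm, Set.inter_eq_left.2, Measure.prod_prod,
      Real.volume_Ico, sub_zero]
    rintro ⟨x, s⟩ ⟨hx, hs⟩
    exact ⟨hs.1, hs.2.trans_le (hεc.trans (hfE x hx))⟩
  have hle : ∀ᶠ n in atTop, specialMeasure volume f
      (E ×ˢ Set.Ico 0 ε ∩ specialFlow (circleRotation α) f (τ n) ⁻¹' (E ×ˢ Set.Ico 0 ε)) ≤
      ENNReal.ofReal (C * ε) * ENNReal.ofReal ε := by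
    filter_upwards [hτ.eventually_ge_atTop t₀, hτ.eventually_gt_atTop ε] with n hn hn'
    set G : Set UnitAddCircle := {x | ∃ j, |birkhoffSum (circleRotation α) f j x - τ n| < ε}
      with hG
    have hsub : E ×ˢ Set.Ico 0 ε ∩ specialFlow (circleRotation α) f (τ n) ⁻¹' (E ×ˢ Set.Ico 0 ε) ⊆
        G ×ˢ Set.Ico 0 ε := by
      rintro ⟨x, s⟩ ⟨⟨_, hs⟩, _, hs'⟩
      exact ⟨exists_abs_birkhoffSum_sub_lt hpos hn' hs hs', hs⟩
    have hGle : volume G ≤ ENNReal.ofReal (C * ε) := by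
      refine (volume_le_volume_representatives G).trans (le_trans (measure_mono ?_) (ht₀ _ hn))
      rintro x ⟨hx, j, hj⟩
      exact ⟨hx, j, by rwa [birkhoffSum_circleRotation] at hj⟩
    calc _ ≤ (volume.prod volume) (G ×ˢ Set.Ico 0 ε) :=
          (Measure.restrict_apply_le _ _).trans (measure_mono hsub)
      _ = volume G * ENNReal.ofReal ε := by
          rw [Measure.prod_prod, Real.volume_Ico, sub_zero]
      _ ≤ _ := by gcongr
  have hlim : liminf (fun n => specialMeasure volume f
      (E ×ˢ Set.Ico 0 ε ∩ specialFlow (circleRotation α) f (τ n) ⁻¹' (E ×ˢ Set.Ico 0 ε))) atTop ≤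
      ENNReal.ofReal (C * ε) * ENNReal.ofReal ε :=
    liminf_le_of_frequently_le' hle.frequently
  have hfin := (hrig _ hAm).trans hlim
  rw [hA, ← mul_assoc] at hfin
  have hεpos : ENNReal.ofReal ε ≠ 0 := (ENNReal.ofReal_pos.2 hε0).ne'
  exact hεE.not_ge ((ENNReal.mul_le_mul_iff_left hεpos ENNReal.ofReal_ne_top).1 hfin)
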